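/- **Setting (kick-model of a dive).** Let $R_x(a)$ be the rotation by $a$ about the $x$-axis. A diver with space-fixed angular momentum $\boldsymbol\ell$, $|\boldsymbol\ell|=l>0$, moves in five stages of durations $\tau_1,\dots,\tau_5\ge 0$. In stages 1, 3, 5 the attitude $R(t)\in SO(3)$ is that of a free rigid body with tensor of inertia $I$: $\dot R v=R(\Omega\times v)$ for all $v \in \mathbb R^3$, where $\Omega=I^{-1}L$ and $L=R^t\boldsymbol\ell$. In stages 1 and 5, $I$ is diagonal and $L=(0,l,0)^t$ (steady somersault). In stage 3, $I=I_t=R_x(\mathcal P)\,\mathrm{diag}(J_x,J_y,J_z)\,R_x(-\mathcal P)$ with $J_x,J_y,J_z>0$. Stages 2 and 4 are instantaneous kicks ($\tau_2=\tau_4=0$), which turn $L$ by $R_x(-\chi)$ and back by $R_x(\chi)$. Let $L_t=R_x(-\chi)(0,l,0)^t$ and $E_t=\tfrac12 L_t\cdot I_t^{-1}L_t$. Assume that stage 3 is a twisting motion, i.e. that the orbit of $L$ goes around the principal axis $u=R_x(\mathcal P)e_z$ of the smallest moment of inertia: $\max\big(\tfrac{1}{J_x},\tfrac1{J_y}\big)<2E_t/l^2<\tfrac1{J_z}$.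 Let $T_t$ be the smallest period of $L$ in stage 3 (continued to all times), and $S$ the solid angle (area divided by $l^2$) of the slice of the sphere $|L|=l$ between the equator orthogonal to $u$ and the orbit of $L$. The dive has $n\in\mathbb{N}$ twists if $\tau_3=nT_t$. It has $m\in\mathbb{R}$ somersaults if $2\pi m$ is the total amount of rotation about $\boldsymbol\ell$, not reduced modulo $2\pi$: the sum over stages 1, 3, 5 of the change of the continuous angle about $\boldsymbol\ell$ of the body axis $e_z$ (stages 1 and 5), respectively $u$ (stage 3). The dive is *pure* if $\tau_1=\tau_2=\tau_4=\tau_5=0$. **Corollary (pure twisting somersault).** The period $T_t$ exists. Both $S$ and $l\,T_t$ are functions of $E_t/l^2$ only, besides the moments of inertia $J_x,J_y,J_z$. A pure dive with $n$ twists has $m$ somersaults if and only if $$2\pi m=\Big(2\,l\,T_t\,\frac{E_t}{l^2}-S\Big)\,n .$$ In that case, if $n\ge1$, $m/n$ is a rotation number of the Euler top with tensor of inertia $I_t$: it is the limit as $t\to\infty$ of the number of turns of $u$ about $\boldsymbol\ell$ in time $t$, divided by $t/T_t$, along the stage 3 motion continued to all times. -/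

import Mathlib

open scoped Matrix

noncomputable section

namespace TwistingSomersault

/-- Rotation by the angle `a` about the `x`-axis. -/
def Rx (a : ℝ) : Matrix (Fin 3) (Fin 3) ℝ :=
  !![1, 0, 0; 0, Real.cos a, -Real.sin a; 0, Real.sin a, Real.cos a]

/-- Rotational energy `½ L · I⁻¹ L` of a rigid body with tensor of inertia `I` and body-frame
angular momentum `L`. -/
def rigidEnergy (I : Matrix (Fin 3) (Fin 3) ℝ) (L : Fin 3 → ℝ) : ℝ :=
  (1 / 2) * (L ⬝ᵥ (I⁻¹ *ᵥ L))

/-- `R` is the attitude (body frame to space frame) of a free rigid body with tensor of inertia `I`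
and space-fixed angular momentum `ell`: `R t` is a rotation, the body-frame angular momentum is
`L = Rᵀ ell`, the body-frame angular velocity is `Ω = I⁻¹ L`, and `Ṙ v = R (Ω × v)` for all `v`.
(The Euler equation `L̇ = L × Ω` follows.) -/
structure IsFreeMotion (I : Matrix (Fin 3) (Fin 3) ℝ) (ell : Fin 3 → ℝ)
    (R : ℝ → Matrix (Fin 3) (Fin 3) ℝ) : Prop where
  rotation : ∀ t, R t ∈ Matrix.specialOrthogonalGroup (Fin 3) ℝ
  velocity : ∀ (t : ℝ) (v : Fin 3 → ℝ),
    HasDerivAt (fun s => R s *ᵥ v)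
      (R t *ᵥ (crossProduct (I⁻¹ *ᵥ ((R t)ᵀ *ᵥ ell)) v)) t

/-- `phi` is a continuous choice of the angle of the moving vector `w` about the axis `ell`
(right-handed, not reduced modulo `2π`): the component of `w t` orthogonal to `ell` is a positive
multiple of `cos (phi t) a + sin (phi t) b`, where `(a, b, ell / |ell|)` is a fixed
positively oriented orthonormal frame. -/
def IsAngleAbout (ell : Fin 3 → ℝ) (w : ℝ → Fin 3 → ℝ) (phi : ℝ → ℝ) : Prop :=
  Continuous phi ∧ ∃ a b : Fin 3 → ℝ,
    a ⬝ᵥ a = 1 ∧ a ⬝ᵥ ell = 0 ∧ Real.sqrt (ell ⬝ᵥ ell) • b = crossProduct ell a ∧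
    ∀ t, ∃ r c : ℝ, 0 < r ∧
      w t = r • (Real.cos (phi t) • a + Real.sin (phi t) • b) + c • ell

/-- The solid angle `area / l²` of a part `A` of the sphere of radius `l` about the origin
of `ℝ³`, measured by the surface measure of the unit sphere. -/
def sphereSolidAngle (l : ℝ) (A : Set (Fin 3 → ℝ)) : ℝ :=
  ((MeasureTheory.volume : MeasureTheory.Measure (EuclideanSpace ℝ (Fin 3))).toSphere
    {x : Metric.sphere (0 : EuclideanSpace ℝ (Fin 3)) 1 |
      (fun i => l * (x : EuclideanSpace ℝ (Fin 3)) i) ∈ A}).toReal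

/-- The slice of the sphere of radius `l` that is bounded by the equator orthogonal to the unit
vector `u` and a closed curve `C` around the axis `u`: the union of the meridian arcs
from the equator to the points `y` of `C`. -/
def equatorSlice (u : Fin 3 → ℝ) (l : ℝ) (C : Set (Fin 3 → ℝ)) : Set (Fin 3 → ℝ) :=
  {x | x ⬝ᵥ x = l ^ 2 ∧ ∃ y ∈ C,
    (∃ r : ℝ, 0 < r ∧ x - (x ⬝ᵥ u) • u = r • (y - (y ⬝ᵥ u) • u)) ∧
    x ⬝ᵥ u ∈ Set.uIcc 0 (y ⬝ᵥ u)}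

/-- The tensor of inertia `I_t` in the twisting stage, with principal moments `J` and
`Rx (-P) * I_t * Rx P = diag J`. -/
def twistInertia (J : Fin 3 → ℝ) (P : ℝ) : Matrix (Fin 3) (Fin 3) ℝ :=
  Rx P * Matrix.diagonal J * Rx (-P)

/-- A dive of the kick-model whose twisting stage has principal moments of inertia `J`.
The stages 1, ..., 5 have the durations `tau 0, ..., tau 4`, each of the stages 1, 3, 5 has its
own clock that starts at `0`.  Stages 1 and 5 are steady rotations about the `y`-axis with
diagonal tensor of inertia `diag Is`; stage 3 is a free motion with tensor of inertia `I_t`;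
stages 2 and 4 are instantaneous kicks, which
turn the body-frame angular momentum by `Rx (-chi)` and back by `Rx chi`. -/
structure KickDive (J : Fin 3 → ℝ) where
  /-- Principal moments of inertia in the somersault stages. -/
  Is : Fin 3 → ℝ
  /-- Angle of the principal axes in the twisting stage. -/
  P : ℝ
  /-- Tilt angle of the kick. -/
  chi : ℝ
  /-- Size of the angular momentum. -/
  l : ℝ
  /-- Angular momentum in the space-fixed frame. -/
  ell : Fin 3 → ℝ
  /-- Durations of the five stages. -/
  tau : Fin 5 → ℝ
  /-- Attitudes in stages 1, 3, 5. -/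
  R1 : ℝ → Matrix (Fin 3) (Fin 3) ℝ
  R3 : ℝ → Matrix (Fin 3) (Fin 3) ℝ
  R5 : ℝ → Matrix (Fin 3) (Fin 3) ℝ
  Is_pos : ∀ i, 0 < Is i
  l_pos : 0 < l
  tau_nonneg : ∀ i, 0 ≤ tau i
  kick_instantaneous : tau 1 = 0 ∧ tau 3 = 0
  stage1 : IsFreeMotion (Matrix.diagonal Is) ell R1
  stage1_equilibrium : (R1 0)ᵀ *ᵥ ell = ![0, l, 0]
  stage2 : R3 0 = R1 (tau 0) * Rx chi
  stage3 : IsFreeMotion (twistInertia J P) ell R3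
  stage4 : R5 0 = R3 (tau 2) * Rx (-chi)
  stage5 : IsFreeMotion (Matrix.diagonal Is) ell R5
  stage5_equilibrium : (R5 0)ᵀ *ᵥ ell = ![0, l, 0]

namespace KickDive

variable {J : Fin 3 → ℝ} (d : KickDive J)

/-- Body-frame angular momentum along the stage 3 motion (continued to all times). -/
def momentum (t : ℝ) : Fin 3 → ℝ := (d.R3 t)ᵀ *ᵥ d.ell

/-- The energy `E_t` of the twisting stage: the energy just after the first kick. -/
def Et : ℝ := rigidEnergy (twistInertia J d.P) (Rx (-d.chi) *ᵥ ![0, d.l, 0])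

/-- The twist axis in the body frame: the third principal axis of `I_t`. -/
def twistAxis : Fin 3 → ℝ := Rx d.P *ᵥ ![0, 0, 1]

/-- The kick leads to a periodic orbit that goes around the twist axis, the axis
of the smallest moment of inertia: `E_t` is larger than the energy of the rotations about the
other two principal axes and smaller than that of the rotation about the twist axis. -/
def IsTwisting : Prop :=
  d.l ^ 2 / (2 * J 0) < d.Et ∧ d.l ^ 2 / (2 * J 1) < d.Et ∧ d.Et < d.l ^ 2 / (2 * J 2)

/-- The periods of the angular momentum in the twisting stage. -/
def periods : Set ℝ := {T | 0 < T ∧ ∀ t, d.momentum (t + T) = d.momentum t}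

/-- `T_t`, the smallest period. -/
def Tt : ℝ := sInf d.periods

/-- `S`: the solid angle between the equator and the orbit of the angular momentum in stage 3. -/
def S : ℝ := sphereSolidAngle d.l (equatorSlice d.twistAxis d.l (Set.range d.momentum))

/-- The dive performs `n` twists: stage 3 consists of `n` revolutions of the periodic orbit. -/
def HasTwists (n : ℕ) : Prop := d.tau 2 = n * d.Tt

/-- `delta` is the total amount of rotation about the angular momentum axis, the sum over
the stages of the angle (not modulo `2π`) by which the head-to-toe axis (stages 1 and 5) or the
twist axis (stage 3) has turned about `ell`.  The kicks move these axes in a plane through `ell`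
and do not contribute. -/
def HasTotalRotation (delta : ℝ) : Prop :=
  ∃ phi1 phi3 phi5 : ℝ → ℝ,
    IsAngleAbout d.ell (fun t => d.R1 t *ᵥ ![0, 0, 1]) phi1 ∧
    IsAngleAbout d.ell (fun t => d.R3 t *ᵥ d.twistAxis) phi3 ∧
    IsAngleAbout d.ell (fun t => d.R5 t *ᵥ ![0, 0, 1]) phi5 ∧
    delta = (phi1 (d.tau 0) - phi1 0) + (phi3 (d.tau 2) - phi3 0) + (phi5 (d.tau 4) - phi5 0)

/-- The dive performs `m` somersaults. -/
def HasSomersaults (m : ℝ) : Prop := d.HasTotalRotation (2 * Real.pi * m)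

/-- Only stage 3 takes time. -/
def IsPure : Prop := d.tau 0 = 0 ∧ d.tau 1 = 0 ∧ d.tau 3 = 0 ∧ d.tau 4 = 0

/-- `W` is the rotation number of the Euler top of stage 3 on the torus of its motion: the ratio
of the mean frequency of the rotation about `ell` and the frequency of the orbit
of the angular momentum, that is, the limit of the number of turns about `ell` per revolution. -/
def IsRotationNumber (W : ℝ) : Prop :=
  ∃ phi : ℝ → ℝ, IsAngleAbout d.ell (fun t => d.R3 t *ᵥ d.twistAxis) phi ∧
    Filter.Tendsto (fun t => ((phi t - phi 0) / (2 * Real.pi)) / (t / d.Tt))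
      Filter.atTop (nhds W)

end KickDive

end TwistingSomersault

end

/-! In principal axes, let a, b, c be the inverse moments, g(u) = a cos² u + b sin² u (`transverse`)
and h = 2E_t/l². Sphere and energy together give (z/l)² (c - g(u)) = h - g(u) at longitude u about
the twist axis. Since a, b < h < c, the orbit is a graph z = ±l·`height` over the equator and never
meets equator or pole. Euler's equations turn the longitude at the rate ∓l·`speed`, with `speed` =
(c - g)·`height` > 0. The orbit therefore closes up exactly when the longitude has made a full turn,
and l T_t is the integral of 1/`speed` over a turn (`IsEulerOrbit.exists_isLongitude`,
`isLeast_periods`).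

The twist axis turns about the angular momentum at the rate l (a x² + b y²)/(x² + y²) = l g(u)
(`IsFreeMotion.axis_angle`). One revolution contributes the integral of g/`speed`. As (h -
g)/`speed` = `height`, this equals h·(l T_t) minus the integral of `height`
(`travelAngle_add_two_pi`).

By Archimedes' theorem on the sphere and the cylinder, the integral of `height` over the longitude
is the solid angle S. Here it is obtained from the volume of the cone over the slice, which is a
third of the solid angle (`volume_solidSlice`, `sphereSolidAngle_equatorSlice`). Thus each twist
gives the rotation 2 l T_t E_t/l² - S. An angle with constant gain per period has a mean velocity,
and this is the rotation number (`tendsto_mean_of_add_period`). -/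

noncomputable section

namespace TwistingSomersault

open Real Filter Topology

/-! ### Lifting plane curves to polar coordinates -/

theorem exists_polar (p q : ℝ) :
    ∃ φ : ℝ, p = √(p ^ 2 + q ^ 2) * cos φ ∧ q = √(p ^ 2 + q ^ 2) * sin φ := by
  have hn : ‖(⟨p, q⟩ : ℂ)‖ = √(p ^ 2 + q ^ 2) := by
    rw [Complex.norm_eq_sqrt_sq_add_sq]
  exact ⟨Complex.arg ⟨p, q⟩, by rw [← hn, Complex.norm_mul_cos_arg],
    by rw [← hn, Complex.norm_mul_sin_arg]⟩

/-- A curve in the punctured plane with continuous angular velocity `k` has a polar angle with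
derivative `k`. -/
theorem exists_polar_lift {p q p' q' k : ℝ → ℝ} (hp : ∀ t, HasDerivAt p (p' t) t)
    (hq : ∀ t, HasDerivAt q (q' t) t) (hk : Continuous k) (hpos : ∀ t, 0 < p t ^ 2 + q t ^ 2)
    (h : ∀ t, p t * q' t - q t * p' t = k t * (p t ^ 2 + q t ^ 2)) :
    ∃ φ : ℝ → ℝ, (∀ t, HasDerivAt φ (k t) t) ∧
      ∀ t, p t = √(p t ^ 2 + q t ^ 2) * cos (φ t) ∧ q t = √(p t ^ 2 + q t ^ 2) * sin (φ t) := by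
  set ρ : ℝ → ℝ := fun t => √(p t ^ 2 + q t ^ 2) with hρ
  have ρpos : ∀ t, 0 < ρ t := fun t => Real.sqrt_pos.2 (hpos t)
  have ρsq : ∀ t, ρ t ^ 2 = p t ^ 2 + q t ^ 2 := fun t => Real.sq_sqrt (hpos t).le
  obtain ⟨φ₀, hc0, hs0⟩ := exists_polar (p 0) (q 0)
  have hφ : ∀ t, HasDerivAt (fun t => φ₀ + ∫ s in (0 : ℝ)..t, k s) (k t) t := fun t =>
    (intervalIntegral.integral_hasDerivAt_right (hk.intervalIntegrable _ _)
      (hk.stronglyMeasurableAtFilter _ _) hk.continuousAt).const_add _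
  set φ : ℝ → ℝ := fun t => φ₀ + ∫ s in (0 : ℝ)..t, k s with hφdef
  have hφ0 : φ 0 = φ₀ := by simp [hφdef]
  have hρ' : ∀ t, HasDerivAt ρ ((p t * p' t + q t * q' t) / ρ t) t := fun t => by
    have := (((hp t).pow 2).add ((hq t).pow 2)).sqrt (hpos t).ne'
    refine this.congr_deriv ?_
    simp only [Pi.add_apply, Pi.pow_apply]
    have := (ρpos t).ne'
    simp only [hρ] at this ⊢
    field_simp
    ring
  have hu : ∀ t, HasDerivAt (fun t => p t / ρ t) (-k t * (q t / ρ t)) t := fun t => by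
    refine ((hp t).div (hρ' t) (ρpos t).ne').congr_deriv ?_
    have h1 := (ρpos t).ne'
    field_simp
    have := h t
    rw [← ρsq] at this
    linear_combination (p' t) * ρsq t - q t * this
  have hv : ∀ t, HasDerivAt (fun t => q t / ρ t) (k t * (p t / ρ t)) t := fun t => by
    refine ((hq t).div (hρ' t) (ρpos t).ne').congr_deriv ?_
    have h1 := (ρpos t).ne'
    field_simp
    have := h t
    rw [← ρsq] at this
    linear_combination (q' t) * ρsq t + p t * this
  -- `hX` and `hY` compute the coordinates of the unit vector (p/ρ, q/ρ) in the frame turned by φ.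
  -- Vector and frame have the same angular velocity k, so the coordinates keep their initial values
  -- 1 and 0.
  have hX : ∀ t, p t / ρ t * cos (φ t) + q t / ρ t * sin (φ t) = 1 := fun t => by
    have hd : ∀ t, HasDerivAt (fun t => p t / ρ t * cos (φ t) + q t / ρ t * sin (φ t)) 0 t :=
      fun t => (((hu t).mul (hφ t).cos).add ((hv t).mul (hφ t).sin)).congr_deriv (by ring)
    have := is_const_of_deriv_eq_zero (fun t => (hd t).differentiableAt) (fun t => (hd t).deriv) t 0
    rw [this, hφ0, show p 0 = ρ 0 * cos φ₀ from hc0, show q 0 = ρ 0 * sin φ₀ from hs0]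
    have h1 := (ρpos 0).ne'
    field_simp
    exact cos_sq_add_sin_sq φ₀
  have hY : ∀ t, -(p t / ρ t) * sin (φ t) + q t / ρ t * cos (φ t) = 0 := fun t => by
    have hd : ∀ t, HasDerivAt (fun t => -(p t / ρ t) * sin (φ t) + q t / ρ t * cos (φ t)) 0 t :=
      fun t => (((hu t).neg.mul (hφ t).sin).add ((hv t).mul (hφ t).cos)).congr_deriv (by
        simp only [Pi.neg_apply]; ring)
    have := is_const_of_deriv_eq_zero (fun t => (hd t).differentiableAt) (fun t => (hd t).deriv) t 0
    rw [this, hφ0, show p 0 = ρ 0 * cos φ₀ from hc0, show q 0 = ρ 0 * sin φ₀ from hs0]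
    ring
  refine ⟨φ, hφ, fun t => ?_⟩
  have e := cos_sq_add_sin_sq (φ t)
  have h1 := (ρpos t).ne'
  constructor
  · have : p t / ρ t = cos (φ t) := by
      linear_combination cos (φ t) * hX t - sin (φ t) * hY t - (p t / ρ t) * e
    rw [← this]; exact (mul_div_cancel₀ _ h1).symm
  · have : q t / ρ t = sin (φ t) := by
      linear_combination sin (φ t) * hX t + cos (φ t) * hY t - (q t / ρ t) * e
    rw [← this]; exact (mul_div_cancel₀ _ h1).symm

/-- A continuous function with values in `2πℤ` is constant. -/
theorem eq_of_continuous_of_cos_eq_one {f : ℝ → ℝ} (hf : Continuous f)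
    (h : ∀ t, cos (f t) = 1) (s t : ℝ) : f s = f t := by
  have hpi := Real.pi_pos
  have key : ∀ s t, ¬ f s < f t := fun s t hlt => by
    -- An intermediate value less than 2π above f s cannot be a multiple of 2π.
    obtain ⟨x, hx1, hx2⟩ := exists_between (lt_min hlt (show f s < f s + 2 * π by linarith))
    obtain ⟨r, rfl⟩ := mem_range_of_exists_le_of_exists_ge hf ⟨s, hx1.le⟩
      ⟨t, (hx2.trans_le (min_le_left _ _)).le⟩
    obtain ⟨m, hm⟩ := (Real.cos_eq_one_iff _).1 (h s)
    obtain ⟨n, hn⟩ := (Real.cos_eq_one_iff _).1 (h r)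
    have hx3 := hx2.trans_le (min_le_right _ _)
    rw [← hm, ← hn] at hx1 hx3
    have h1 : (m : ℝ) < n := by nlinarith
    have h2 : (n : ℝ) < m + 1 := by nlinarith
    have h1' : m < n := by exact_mod_cast h1
    have h2' : n < m + 1 := by exact_mod_cast h2
    omega
  exact le_antisymm (not_lt.1 (key t s)) (not_lt.1 (key s t))

/-! ### Orbits of the Euler equations around the third axis -/

/-- The mean of `a` and `b` along the meridian of longitude `x`. -/
def transverse (a b x : ℝ) : ℝ := a * cos x ^ 2 + b * sin x ^ 2

/-- The height over the equator, on the unit sphere, of the energy level `h / 2` at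
longitude `x`. -/
def height (a b c h x : ℝ) : ℝ := √((h - transverse a b x) / (c - transverse a b x))

/-- The speed of the longitude along the orbit, on the unit sphere. -/
def speed (a b c h x : ℝ) : ℝ := (c - transverse a b x) * height a b c h x

/-- The time that the orbit on the unit sphere takes from longitude `0` to longitude `x`. -/
def travelTime (a b c h x : ℝ) : ℝ := ∫ s in (0 : ℝ)..x, (speed a b c h s)⁻¹

/-- The period of the orbit on the unit sphere. -/
def orbitPeriod (a b c h : ℝ) : ℝ := ∫ s in (-π)..π, (speed a b c h s)⁻¹

/-- The area between the equator and the orbit. -/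
def orbitArea (a b c h : ℝ) : ℝ := ∫ s in (-π)..π, height a b c h s

/-- The rotation of the third axis while the longitude goes from `0` to `x`. -/
def travelAngle (a b c h x : ℝ) : ℝ :=
  ∫ s in (0 : ℝ)..x, transverse a b s * (speed a b c h s)⁻¹

section

variable {a b c h : ℝ}

theorem continuous_transverse : Continuous (transverse a b) := by
  unfold transverse; fun_prop

theorem transverse_lt (ha : a < h) (hb : b < h) (x : ℝ) : transverse a b x < h := by
  have e := cos_sq_add_sin_sq x
  have h1 : transverse a b x = h - ((h - a) * cos x ^ 2 + (h - b) * sin x ^ 2) := by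
    unfold transverse; linear_combination h * e
  rcases (sq_nonneg (cos x)).lt_or_eq with h2 | h2
  · have := mul_pos (sub_pos.2 ha) h2
    have := mul_nonneg (sub_pos.2 hb).le (sq_nonneg (sin x))
    linarith
  · have h3 : sin x ^ 2 = 1 := by linarith
    rw [h1, ← h2, h3]; linarith

theorem transverse_add_two_pi (x : ℝ) : transverse a b (x + 2 * π) = transverse a b x := by
  simp [transverse]

/-- This is the energy relation on the unit sphere, g (1 - z²) + c z² = h with g the transverse
mean, solved for z². -/
theorem height_sq_mul (ha : a < h) (hb : b < h) (hc : h < c) (x : ℝ) :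
    height a b c h x ^ 2 * (c - transverse a b x) = h - transverse a b x := by
  have h1 := transverse_lt ha hb x
  rw [height, Real.sq_sqrt (div_nonneg (by linarith) (by linarith)),
    div_mul_cancel₀ _ (by linarith)]

theorem height_pos (ha : a < h) (hb : b < h) (hc : h < c) (x : ℝ) : 0 < height a b c h x := by
  have h1 := transverse_lt ha hb x
  exact Real.sqrt_pos.2 (div_pos (by linarith) (by linarith))

theorem height_lt_one (ha : a < h) (hb : b < h) (hc : h < c) (x : ℝ) :
    height a b c h x < 1 := by
  have h1 := transverse_lt ha hb x
  rw [height, Real.sqrt_lt' one_pos, one_pow, div_lt_one (by linarith)]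
  linarith

theorem continuous_height (ha : a < h) (hb : b < h) (hc : h < c) :
    Continuous (height a b c h) := by
  refine Real.continuous_sqrt.comp (Continuous.div ?_ ?_ fun x => ?_)
  · exact continuous_const.sub continuous_transverse
  · exact continuous_const.sub continuous_transverse
  · have := transverse_lt ha hb x
    exact (by linarith : 0 < c - transverse a b x).ne'

theorem height_add_two_pi (x : ℝ) : height a b c h (x + 2 * π) = height a b c h x := by
  simp [height, transverse_add_two_pi]

theorem speed_pos (ha : a < h) (hb : b < h) (hc : h < c) (x : ℝ) : 0 < speed a b c h x := by
  have h1 := transverse_lt ha hb x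
  exact mul_pos (by linarith) (height_pos ha hb hc x)

theorem continuous_speed (ha : a < h) (hb : b < h) (hc : h < c) : Continuous (speed a b c h) :=
  (continuous_const.sub continuous_transverse).mul (continuous_height ha hb hc)

theorem continuous_inv_speed (ha : a < h) (hb : b < h) (hc : h < c) :
    Continuous fun x => (speed a b c h x)⁻¹ :=
  (continuous_speed ha hb hc).inv₀ fun x => (speed_pos ha hb hc x).ne'

theorem speed_add_two_pi (x : ℝ) : speed a b c h (x + 2 * π) = speed a b c h x := by
  simp [speed, height_add_two_pi, transverse_add_two_pi]

theorem hasDerivAt_primitive {f : ℝ → ℝ} (hf : Continuous f) (x : ℝ) :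
    HasDerivAt (fun x => ∫ s in (0 : ℝ)..x, f s) (f x) x :=
  intervalIntegral.integral_hasDerivAt_right (hf.intervalIntegrable _ _)
    (hf.stronglyMeasurableAtFilter _ _) hf.continuousAt

theorem primitive_add_two_pi {f : ℝ → ℝ} (hf : Continuous f) (hper : ∀ x, f (x + 2 * π) = f x)
    (x : ℝ) : ∫ s in (0 : ℝ)..(x + 2 * π), f s =
      (∫ s in (0 : ℝ)..x, f s) + ∫ s in (-π)..π, f s := by
  have h1 := Function.Periodic.intervalIntegral_add_eq (f := f) (T := 2 * π) hper x (-π)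
  rw [show -π + 2 * π = π by ring] at h1
  rw [← h1, intervalIntegral.integral_add_adjacent_intervals] <;>
    exact hf.intervalIntegrable _ _

/-- Translation by `2π` as a rule for all integer multiples. -/
theorem add_int_mul_two_pi {G : ℝ → ℝ} {A : ℝ} (hG : ∀ x, G (x + 2 * π) = G x + A) (x : ℝ)
    (k : ℤ) : G (x + k * (2 * π)) = G x + k * A := by
  induction k using Int.induction_on with
  | zero => simp
  | succ n ih =>
    have := hG (x + n * (2 * π))
    push_cast at ih ⊢
    rw [show x + (n + 1) * (2 * π) = x + n * (2 * π) + 2 * π by ring, this, ih]; ring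
  | pred n ih =>
    have := hG (x + (-n - 1) * (2 * π))
    push_cast at ih ⊢
    rw [show x + (-n - 1) * (2 * π) + 2 * π = x + -n * (2 * π) by ring, ih] at this
    linarith

theorem hasDerivAt_travelTime (ha : a < h) (hb : b < h) (hc : h < c) (x : ℝ) :
    HasDerivAt (travelTime a b c h) (speed a b c h x)⁻¹ x :=
  hasDerivAt_primitive (continuous_inv_speed ha hb hc) x

theorem strictMono_travelTime (ha : a < h) (hb : b < h) (hc : h < c) :
    StrictMono (travelTime a b c h) :=
  strictMono_of_hasDerivAt_pos (hasDerivAt_travelTime ha hb hc)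
    fun x => inv_pos.2 (speed_pos ha hb hc x)

theorem travelTime_add_two_pi (ha : a < h) (hb : b < h) (hc : h < c) (x : ℝ) :
    travelTime a b c h (x + 2 * π) = travelTime a b c h x + orbitPeriod a b c h :=
  primitive_add_two_pi (continuous_inv_speed ha hb hc) (fun x => by rw [speed_add_two_pi]) x

theorem orbitPeriod_pos (ha : a < h) (hb : b < h) (hc : h < c) : 0 < orbitPeriod a b c h := by
  have h1 := travelTime_add_two_pi ha hb hc 0
  have h2 := strictMono_travelTime ha hb hc (show (0 : ℝ) < 0 + 2 * π by positivity)
  linarith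

theorem continuous_travelAngle_integrand (ha : a < h) (hb : b < h) (hc : h < c) :
    Continuous fun x => transverse a b x * (speed a b c h x)⁻¹ :=
  continuous_transverse.mul (continuous_inv_speed ha hb hc)

theorem hasDerivAt_travelAngle (ha : a < h) (hb : b < h) (hc : h < c) (x : ℝ) :
    HasDerivAt (travelAngle a b c h) (transverse a b x * (speed a b c h x)⁻¹) x :=
  hasDerivAt_primitive (continuous_travelAngle_integrand ha hb hc) x

/-- The integrand splits as g/`speed` = h/`speed` - (h - g)/`speed`, and `height_sq_mul` turns the
last term into `height`. This is where the dynamical and the geometric part of the formula separate.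
-/
theorem travelAngle_add_two_pi (ha : a < h) (hb : b < h) (hc : h < c) (x : ℝ) :
    travelAngle a b c h (x + 2 * π) =
      travelAngle a b c h x + (h * orbitPeriod a b c h - orbitArea a b c h) := by
  refine (primitive_add_two_pi (continuous_travelAngle_integrand ha hb hc)
    (fun x => by rw [speed_add_two_pi, transverse_add_two_pi]) x).trans ?_
  rw [orbitPeriod, orbitArea, ← intervalIntegral.integral_const_mul,
    ← intervalIntegral.integral_sub
      (((continuous_inv_speed ha hb hc).const_mul h).intervalIntegrable _ _)
      ((continuous_height ha hb hc).intervalIntegrable _ _)]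
  congr 1
  refine intervalIntegral.integral_congr fun s _ => ?_
  have h1 := transverse_lt ha hb s
  have h2 := height_pos ha hb hc s
  have h3 := height_sq_mul ha hb hc s
  have h4 : c - transverse a b s ≠ 0 := by linarith
  simp only [speed]
  field_simp
  linear_combination h3

end

/-- `(x, y, z)` solves the Euler equations with inverse moments of inertia `a`, `b`, `c`, on the
sphere of radius `l` and with energy `h l² / 2`. -/
structure IsEulerOrbit (a b c h l : ℝ) (x y z : ℝ → ℝ) : Prop where
  deriv_x : ∀ t, HasDerivAt x ((c - b) * (y t * z t)) t
  deriv_y : ∀ t, HasDerivAt y ((a - c) * (x t * z t)) t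
  deriv_z : ∀ t, HasDerivAt z ((b - a) * (x t * y t)) t
  sphere : ∀ t, x t ^ 2 + y t ^ 2 + z t ^ 2 = l ^ 2
  energy : ∀ t, a * x t ^ 2 + b * y t ^ 2 + c * z t ^ 2 = h * l ^ 2

/-- `u` is a longitude along the orbit, and the orbit stays on the side `s` of the equator. -/
structure IsLongitude (a b c h l : ℝ) (x y z u : ℝ → ℝ) (s : ℝ) : Prop where
  sign : s = 1 ∨ s = -1
  deriv : ∀ t, HasDerivAt u (-s * l * speed a b c h (u t)) t
  x_eq : ∀ t, x t = l * √(1 - height a b c h (u t) ^ 2) * cos (u t)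
  y_eq : ∀ t, y t = l * √(1 - height a b c h (u t) ^ 2) * sin (u t)
  z_eq : ∀ t, z t = s * l * height a b c h (u t)

/-! ### Longitude, period and rotation along an orbit -/

section

variable {a b c h l : ℝ} {x y z u : ℝ → ℝ} {s : ℝ}

/-- At a pole the energy would be c l²/2, which exceeds h l²/2. -/
theorem IsEulerOrbit.transverse_pos (H : IsEulerOrbit a b c h l x y z) (hl : 0 < l)
    (hc : h < c) (t : ℝ) : 0 < x t ^ 2 + y t ^ 2 := by
  have h1 := H.sphere t
  have h2 := H.energy t
  by_contra hcon
  have hx : x t ^ 2 = 0 := by nlinarith [sq_nonneg (x t), sq_nonneg (y t)]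
  have hy : y t ^ 2 = 0 := by nlinarith [sq_nonneg (x t), sq_nonneg (y t)]
  have hz : z t ^ 2 = l ^ 2 := by linarith
  rw [hx, hy, hz] at h2
  nlinarith [mul_pos (sub_pos.2 hc) (pow_pos hl 2)]

/-- Every orbit has a longitude. -/
theorem IsEulerOrbit.exists_isLongitude (H : IsEulerOrbit a b c h l x y z) (hl : 0 < l)
    (ha : a < h) (hb : b < h) (hc : h < c) : ∃ u s, IsLongitude a b c h l x y z u s := by
  have hpos := H.transverse_pos hl hc
  have cx : Continuous x := continuous_iff_continuousAt.2 fun t => (H.deriv_x t).continuousAt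
  have cy : Continuous y := continuous_iff_continuousAt.2 fun t => (H.deriv_y t).continuousAt
  have cz : Continuous z := continuous_iff_continuousAt.2 fun t => (H.deriv_z t).continuousAt
  obtain ⟨u, hu, hxy⟩ := exists_polar_lift
    -- This is (x y' - y x')/(x² + y²), with the derivatives taken from the Euler equations.
    (k := fun t => z t * ((a - c) * x t ^ 2 + (b - c) * y t ^ 2) / (x t ^ 2 + y t ^ 2))
    H.deriv_x H.deriv_y
    (Continuous.div (by fun_prop) (by fun_prop) fun t => (hpos t).ne') hpos
    (fun t => by have := (hpos t).ne'; field_simp; ring)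
  have hg : ∀ t, a * x t ^ 2 + b * y t ^ 2 = (x t ^ 2 + y t ^ 2) * transverse a b (u t) :=
    fun t => by
      have h3 := Real.sq_sqrt (hpos t).le
      rw [transverse]
      obtain ⟨e1, e2⟩ := hxy t
      have e1' : x t ^ 2 = (x t ^ 2 + y t ^ 2) * cos (u t) ^ 2 := by
        conv_lhs => rw [e1]
        rw [mul_pow, h3]
      have e2' : y t ^ 2 = (x t ^ 2 + y t ^ 2) * sin (u t) ^ 2 := by
        conv_lhs => rw [e2]
        rw [mul_pow, h3]
      linear_combination a * e1' + b * e2'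
  have hz2 : ∀ t, z t ^ 2 = (l * height a b c h (u t)) ^ 2 := fun t => by
    have h1 := transverse_lt ha hb (u t)
    have h2 := height_sq_mul ha hb hc (u t)
    have h4 : c - transverse a b (u t) ≠ 0 := by linarith
    refine mul_right_cancel₀ h4 ?_
    linear_combination H.energy t - hg t - transverse a b (u t) * H.sphere t - l ^ 2 * h2
  have hlz : ∀ t, 0 < l * height a b c h (u t) := fun t => mul_pos hl (height_pos ha hb hc _)
  have hz0 : ∀ t, z t ≠ 0 := fun t h0 => by
    have := hz2 t
    rw [h0] at this
    nlinarith [pow_pos (hlz t) 2]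
  -- z² is known and z never vanishes, so by the intermediate value theorem z keeps the sign it has
  -- at time 0.
  obtain ⟨s, hs, hzs⟩ : ∃ s : ℝ, (s = 1 ∨ s = -1) ∧ ∀ t, z t = s * l * height a b c h (u t) := by
    rcases (hz0 0).lt_or_gt with h0 | h0
    · refine ⟨-1, Or.inr rfl, fun t => ?_⟩
      rcases sq_eq_sq_iff_eq_or_eq_neg.1 (hz2 t) with e | e
      · obtain ⟨r, hr⟩ := mem_range_of_exists_le_of_exists_ge cz ⟨0, h0.le⟩
          ⟨t, e ▸ (hlz t).le⟩
        exact absurd hr (hz0 r)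
      · rw [e]; ring
    · refine ⟨1, Or.inl rfl, fun t => ?_⟩
      rcases sq_eq_sq_iff_eq_or_eq_neg.1 (hz2 t) with e | e
      · rw [e]; ring
      · obtain ⟨r, hr⟩ := mem_range_of_exists_le_of_exists_ge cz
          ⟨t, e ▸ (neg_nonpos.2 (hlz t).le)⟩ ⟨0, h0.le⟩
        exact absurd hr (hz0 r)
  have hρ : ∀ t, √(x t ^ 2 + y t ^ 2) = l * √(1 - height a b c h (u t) ^ 2) := fun t => by
    rw [show x t ^ 2 + y t ^ 2 = l ^ 2 * (1 - height a b c h (u t) ^ 2) by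
      linear_combination H.sphere t - hz2 t, Real.sqrt_mul (sq_nonneg l), Real.sqrt_sq hl.le]
  refine ⟨u, s, hs, fun t => ?_, fun t => ?_, fun t => ?_, hzs⟩
  · refine (hu t).congr_deriv ?_
    have := (hpos t).ne'
    rw [hzs, speed, div_eq_iff this]
    linear_combination s * l * height a b c h (u t) * hg t
  · rw [← hρ]; exact (hxy t).1
  · rw [← hρ]; exact (hxy t).2

theorem IsLongitude.sq_sign (U : IsLongitude a b c h l x y z u s) : s * s = 1 := by
  rcases U.sign with h | h <;> simp [h]

/-- Separation of variables: dividing u' = -s l `speed` by `speed` makes the travel time of u affine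
in t. -/
theorem IsLongitude.travelTime_eq (U : IsLongitude a b c h l x y z u s)
    (ha : a < h) (hb : b < h) (hc : h < c) (t : ℝ) :
    travelTime a b c h (u t) = travelTime a b c h (u 0) - s * l * t := by
  have hd : ∀ t, HasDerivAt (fun t => travelTime a b c h (u t) + s * l * t) 0 t := fun t => by
    refine (((hasDerivAt_travelTime ha hb hc (u t)).comp t (U.deriv t)).add
      ((hasDerivAt_id t).const_mul (s * l))).congr_deriv ?_
    have := (speed_pos ha hb hc (u t)).ne'
    field_simp
    ring
  have := is_const_of_deriv_eq_zero (fun t => (hd t).differentiableAt) (fun t => (hd t).deriv) t 0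
  linarith

/-- Both sides have the same travel time, which is an injective function of the longitude. The orbit
runs clockwise on the side s = 1, hence the sign. -/
theorem longitude_add (U : IsLongitude a b c h l x y z u s) (hl : 0 < l)
    (ha : a < h) (hb : b < h) (hc : h < c) (n : ℕ) (t : ℝ) :
    u (t + n * (orbitPeriod a b c h / l)) = u t - s * n * (2 * π) := by
  apply (strictMono_travelTime ha hb hc).injective
  obtain ⟨k, hk⟩ : ∃ k : ℤ, (k : ℝ) = -s * n := by
    rcases U.sign with rfl | rfl
    · exact ⟨-n, by simp⟩
    · exact ⟨n, by simp⟩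
  rw [show u t - s * n * (2 * π) = u t + k * (2 * π) by rw [hk]; ring,
    add_int_mul_two_pi (travelTime_add_two_pi ha hb hc), U.travelTime_eq ha hb hc (_ + _),
    U.travelTime_eq ha hb hc t, hk]
  field_simp
  ring

theorem longitude_surjective (U : IsLongitude a b c h l x y z u s) (hl : 0 < l)
    (ha : a < h) (hb : b < h) (hc : h < c) : Function.Surjective u := fun v => by
  refine ⟨s * (travelTime a b c h (u 0) - travelTime a b c h v) / l,
    (strictMono_travelTime ha hb hc).injective ?_⟩
  rw [U.travelTime_eq ha hb hc]
  have := U.sq_sign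
  field_simp
  linear_combination (travelTime a b c h v - travelTime a b c h (u 0)) * this

theorem isLeast_periods (U : IsLongitude a b c h l x y z u s) (hl : 0 < l)
    (ha : a < h) (hb : b < h) (hc : h < c) :
    IsLeast {T | 0 < T ∧ ∀ t, x (t + T) = x t ∧ y (t + T) = y t ∧ z (t + T) = z t}
      (orbitPeriod a b c h / l) := by
  constructor
  · refine ⟨div_pos (orbitPeriod_pos ha hb hc) hl, fun t => ?_⟩
    have h1 : u (t + orbitPeriod a b c h / l) = u t - s * (2 * π) := by
      simpa using longitude_add U hl ha hb hc 1 t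
    have h2 : height a b c h (u t - s * (2 * π)) = height a b c h (u t) ∧
        cos (u t - s * (2 * π)) = cos (u t) ∧ sin (u t - s * (2 * π)) = sin (u t) := by
      rcases U.sign with rfl | rfl
      · rw [one_mul, cos_sub_two_pi, sin_sub_two_pi, ← height_add_two_pi (u t - 2 * π),
          sub_add_cancel]
        simp
      · rw [show u t - -1 * (2 * π) = u t + 2 * π by ring, height_add_two_pi, cos_add_two_pi,
          sin_add_two_pi]
        simp
    rw [U.x_eq, U.y_eq, U.z_eq, h1, h2.1, h2.2.1, h2.2.2, ← U.x_eq, ← U.y_eq, ← U.z_eq]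
    simp
  · rintro T ⟨hT, hper⟩
    obtain ⟨hx, hy, hz⟩ := hper 0
    -- A return at the single time T is enough: equal heights make the radii equal, so the longitude
    -- has changed by 2πk. Then T l is the positive multiple -s k of `orbitPeriod`, and this integer
    -- is at least 1.
    rw [zero_add] at hx hy hz
    have hH : height a b c h (u T) = height a b c h (u 0) := by
      rw [U.z_eq, U.z_eq] at hz
      refine mul_left_cancel₀ (mul_ne_zero ?_ hl.ne') hz
      intro h0
      have := U.sq_sign
      rw [h0] at this
      norm_num at this
    have hr : l * √(1 - height a b c h (u 0) ^ 2) ≠ 0 := by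
      refine mul_ne_zero hl.ne' (Real.sqrt_pos.2 ?_).ne'
      nlinarith [height_pos ha hb hc (u 0), height_lt_one ha hb hc (u 0)]
    rw [U.x_eq, U.x_eq, hH] at hx
    rw [U.y_eq, U.y_eq, hH] at hy
    have hcos := mul_left_cancel₀ hr hx
    have hsin := mul_left_cancel₀ hr hy
    obtain ⟨k, hk⟩ := (Real.cos_eq_one_iff (u T - u 0)).1 (by
      rw [cos_sub, hcos, hsin]; linear_combination cos_sq_add_sin_sq (u 0))
    have h3 := U.travelTime_eq ha hb hc T
    rw [show u T = u 0 + k * (2 * π) by linarith,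
      add_int_mul_two_pi (travelTime_add_two_pi ha hb hc)] at h3
    have hP := orbitPeriod_pos ha hb hc
    rw [div_le_iff₀ hl]
    have h4 : T * l = ((-s * k : ℝ)) * orbitPeriod a b c h := by
      linear_combination s * h3 - (T * l) * U.sq_sign
    have h5 : 0 < (-s * k : ℝ) := by
      by_contra hcon
      nlinarith [mul_pos hT hl]
    have h6 : (1 : ℝ) ≤ -s * k := by
      rcases U.sign with rfl | rfl
      · have : 0 < -k := by
          have : (0 : ℝ) < ((-k : ℤ) : ℝ) := by push_cast; linarith
          exact_mod_cast this
        have : (1 : ℝ) ≤ ((-k : ℤ) : ℝ) := by exact_mod_cast this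
        push_cast at this
        linarith
      · have : 0 < k := by
          have : (0 : ℝ) < (k : ℝ) := by linarith
          exact_mod_cast this
        have : (1 : ℝ) ≤ (k : ℝ) := by exact_mod_cast this
        linarith
    rw [h4]
    nlinarith

/-- Along the orbit `travelAngle` of the longitude has derivative -s l g(u), that is -s times the
derivative of φ. -/
theorem rotation_eq (U : IsLongitude a b c h l x y z u s)
    (ha : a < h) (hb : b < h) (hc : h < c) {φ : ℝ → ℝ}
    (hφ : ∀ t, HasDerivAt φ (l * transverse a b (u t)) t) (t : ℝ) :
    φ t - φ 0 = -s * (travelAngle a b c h (u t) - travelAngle a b c h (u 0)) := by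
  have hd : ∀ t, HasDerivAt (fun t => φ t + s * travelAngle a b c h (u t)) 0 t := fun t => by
    refine ((hφ t).add
      (((hasDerivAt_travelAngle ha hb hc (u t)).comp t (U.deriv t)).const_mul s)).congr_deriv ?_
    have := (speed_pos ha hb hc (u t)).ne'
    field_simp
    linear_combination (-l * transverse a b (u t)) * U.sq_sign
  have := is_const_of_deriv_eq_zero (fun t => (hd t).differentiableAt) (fun t => (hd t).deriv) t 0
  linarith

/-- The rotation during `n` revolutions. -/
theorem rotation_add_periods (U : IsLongitude a b c h l x y z u s) (hl : 0 < l)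
    (ha : a < h) (hb : b < h) (hc : h < c) {φ : ℝ → ℝ}
    (hφ : ∀ t, HasDerivAt φ (l * transverse a b (u t)) t) (n : ℕ) (t : ℝ) :
    φ (t + n * (orbitPeriod a b c h / l)) =
      φ t + n * (h * orbitPeriod a b c h - orbitArea a b c h) := by
  -- The longitude makes -s n turns. The sign drops out of the rotation because s² = 1.
  obtain ⟨k, hk⟩ : ∃ k : ℤ, (k : ℝ) = -s * n := by
    rcases U.sign with rfl | rfl
    · exact ⟨-n, by simp⟩
    · exact ⟨n, by simp⟩
  have h1 := rotation_eq U ha hb hc hφ t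
  have h2 := rotation_eq U ha hb hc hφ (t + n * (orbitPeriod a b c h / l))
  rw [longitude_add U hl ha hb hc,
    show u t - s * n * (2 * π) = u t + k * (2 * π) by rw [hk]; ring,
    add_int_mul_two_pi (travelAngle_add_two_pi ha hb hc), hk] at h2
  linear_combination h2 - h1 +
    n * (h * orbitPeriod a b c h - orbitArea a b c h) * U.sq_sign

end

/-- A continuous function that increases by `A` in each time interval of length `T` has mean
velocity `A / T`. -/
theorem tendsto_mean_of_add_period {φ : ℝ → ℝ} {T A : ℝ} (hφ : Continuous φ) (hT : 0 < T)
    (h : ∀ t, φ (t + T) = φ t + A) :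
    Tendsto (fun t => ((φ t - φ 0) / (2 * π)) / (t / T)) atTop (𝓝 (A / (2 * π))) := by
  -- Without its linear growth the angle is periodic, hence bounded, and does not affect the mean.
  set f : ℝ → ℝ := fun t => φ t - φ 0 - t / T * A with hf
  have hper : Function.Periodic f T := fun t => by
    simp only [hf, h]
    field_simp
    ring
  have hcont : Continuous f := by fun_prop
  obtain ⟨C, hC⟩ := (hper.isBounded_of_continuous hT.ne' hcont).exists_norm_le
  have hC' : ∀ t, |f t| ≤ C := fun t => hC _ ⟨t, rfl⟩
  have h0 : Tendsto (fun t => f t * t⁻¹) atTop (𝓝 0) := by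
    refine squeeze_zero_norm' (a := fun t => C * t⁻¹) ?_ ?_
    · filter_upwards [eventually_gt_atTop 0] with t ht
      rw [norm_mul, Real.norm_eq_abs, Real.norm_eq_abs, abs_of_pos (inv_pos.2 ht)]
      exact mul_le_mul_of_nonneg_right (hC' t) (inv_pos.2 ht).le
    · simpa using tendsto_inv_atTop_zero.const_mul C
  have h1 := (h0.const_mul (T / (2 * π))).add_const (A / (2 * π))
  rw [mul_zero, zero_add] at h1
  refine h1.congr' ?_
  filter_upwards [eventually_gt_atTop 0] with t ht
  simp only [hf]
  have := Real.pi_pos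
  field_simp
  ring

/-! ### Rotations -/

section Rotation

variable {R : Matrix (Fin 3) (Fin 3) ℝ}

theorem transpose_mul_self_of_rotation (hR : R ∈ Matrix.specialOrthogonalGroup (Fin 3) ℝ) :
    Rᵀ * R = 1 :=
  (Matrix.mem_orthogonalGroup_iff' _ _).1 (Matrix.mem_specialOrthogonalGroup_iff.1 hR).1

theorem mul_transpose_self_of_rotation (hR : R ∈ Matrix.specialOrthogonalGroup (Fin 3) ℝ) :
    R * Rᵀ = 1 :=
  (Matrix.mem_orthogonalGroup_iff _ _).1 (Matrix.mem_specialOrthogonalGroup_iff.1 hR).1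

theorem transpose_mem_rotation (hR : R ∈ Matrix.specialOrthogonalGroup (Fin 3) ℝ) :
    Rᵀ ∈ Matrix.specialOrthogonalGroup (Fin 3) ℝ := by
  rw [Matrix.mem_specialOrthogonalGroup_iff, Matrix.mem_orthogonalGroup_iff,
    Matrix.transpose_transpose, Matrix.det_transpose]
  exact ⟨transpose_mul_self_of_rotation hR, (Matrix.mem_specialOrthogonalGroup_iff.1 hR).2⟩

theorem dotProduct_mulVec_eq (M : Matrix (Fin 3) (Fin 3) ℝ) (v w : Fin 3 → ℝ) :
    v ⬝ᵥ (M *ᵥ w) = (Mᵀ *ᵥ v) ⬝ᵥ w := by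
  rw [Matrix.dotProduct_mulVec, Matrix.mulVec_transpose]

theorem rotation_dotProduct (hR : R ∈ Matrix.specialOrthogonalGroup (Fin 3) ℝ)
    (v w : Fin 3 → ℝ) : (R *ᵥ v) ⬝ᵥ (R *ᵥ w) = v ⬝ᵥ w := by
  rw [dotProduct_mulVec_eq, Matrix.mulVec_mulVec, transpose_mul_self_of_rotation hR,
    Matrix.one_mulVec]

/-- Paired with a test vector, both sides become triple products, that is determinants, and det R =
1. -/
theorem rotation_cross (hR : R ∈ Matrix.specialOrthogonalGroup (Fin 3) ℝ)
    (v w : Fin 3 → ℝ) :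
    R *ᵥ (crossProduct v w) = crossProduct (R *ᵥ v) (R *ᵥ w) := by
  have key : ∀ z : Fin 3 → ℝ,
      z ⬝ᵥ (Rᵀ *ᵥ (crossProduct (R *ᵥ v) (R *ᵥ w))) = z ⬝ᵥ (crossProduct v w) := fun z => by
    rw [dotProduct_mulVec_eq, Matrix.transpose_transpose, triple_product_eq_det,
      triple_product_eq_det]
    have h1 : Matrix.of ![R *ᵥ z, R *ᵥ v, R *ᵥ w] = Matrix.of ![z, v, w] * Rᵀ := by
      ext i j
      rw [Matrix.mul_apply]
      fin_cases i <;> simp [Matrix.mulVec, dotProduct, Fin.sum_univ_three, mul_comm]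
    change (Matrix.of ![R *ᵥ z, R *ᵥ v, R *ᵥ w]).det = (Matrix.of ![z, v, w]).det
    rw [h1, Matrix.det_mul, Matrix.det_transpose, (Matrix.mem_specialOrthogonalGroup_iff.1 hR).2,
      mul_one]
  have h2 : Rᵀ *ᵥ (crossProduct (R *ᵥ v) (R *ᵥ w)) = crossProduct v w :=
    dotProduct_eq _ _ fun z => by rw [dotProduct_comm _ z, dotProduct_comm _ z, key z]
  rw [← h2, Matrix.mulVec_mulVec, mul_transpose_self_of_rotation hR, Matrix.one_mulVec]

theorem Rx_neg (P : ℝ) : Rx (-P) = (Rx P)ᵀ := by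
  ext i j
  fin_cases i <;> fin_cases j <;> simp [Rx]

theorem Rx_mem_rotation (P : ℝ) : Rx P ∈ Matrix.specialOrthogonalGroup (Fin 3) ℝ := by
  have e := cos_sq_add_sin_sq P
  rw [Matrix.mem_specialOrthogonalGroup_iff, Matrix.mem_orthogonalGroup_iff]
  constructor
  · ext i j
    fin_cases i <;> fin_cases j <;> simp [Rx, Matrix.mul_apply, Fin.sum_univ_three] <;>
      linarith
  · rw [Rx, Matrix.det_fin_three]
    simp
    linarith

theorem inv_diagonal {J : Fin 3 → ℝ} (hJ : ∀ i, 0 < J i) :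
    (Matrix.diagonal J)⁻¹ = Matrix.diagonal fun i => (J i)⁻¹ := by
  refine Matrix.inv_eq_left_inv ?_
  rw [Matrix.diagonal_mul_diagonal, ← Matrix.diagonal_one]
  congr 1
  ext i
  exact inv_mul_cancel₀ (hJ i).ne'

theorem inv_twistInertia {J : Fin 3 → ℝ} (hJ : ∀ i, 0 < J i) (P : ℝ) :
    (twistInertia J P)⁻¹ = Rx P * (Matrix.diagonal J)⁻¹ * (Rx P)ᵀ := by
  have h1 := transpose_mul_self_of_rotation (Rx_mem_rotation P)
  have h2 := mul_transpose_self_of_rotation (Rx_mem_rotation P)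
  have h3 : (Matrix.diagonal J)⁻¹ * Matrix.diagonal J = 1 := by
    rw [inv_diagonal hJ, Matrix.diagonal_mul_diagonal, ← Matrix.diagonal_one]
    congr 1
    ext i
    exact inv_mul_cancel₀ (hJ i).ne'
  refine Matrix.inv_eq_left_inv ?_
  rw [twistInertia, Rx_neg]
  calc Rx P * (Matrix.diagonal J)⁻¹ * (Rx P)ᵀ * (Rx P * Matrix.diagonal J * (Rx P)ᵀ)
      = Rx P * (Matrix.diagonal J)⁻¹ * ((Rx P)ᵀ * Rx P) * Matrix.diagonal J * (Rx P)ᵀ := by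
        simp only [Matrix.mul_assoc]
    _ = Rx P * ((Matrix.diagonal J)⁻¹ * Matrix.diagonal J) * (Rx P)ᵀ := by
        rw [h1, Matrix.mul_one]; simp only [Matrix.mul_assoc]
    _ = 1 := by rw [h3, Matrix.mul_one, h2]

end Rotation

/-! ### Free motions -/

/-- The attitude of the principal axes of a body with tensor of inertia `twistInertia J P`. -/
theorem IsFreeMotion.principal {J : Fin 3 → ℝ} (hJ : ∀ i, 0 < J i) {P : ℝ} {ell : Fin 3 → ℝ}
    {R : ℝ → Matrix (Fin 3) (Fin 3) ℝ} (H : IsFreeMotion (twistInertia J P) ell R) :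
    IsFreeMotion (Matrix.diagonal J) ell fun t => R t * Rx P where
  rotation t := mul_mem (H.rotation t) (Rx_mem_rotation P)
  velocity t v := by
    have h := H.velocity t (Rx P *ᵥ v)
    simp only [Matrix.mulVec_mulVec] at h
    refine h.congr_deriv ?_
    rw [← Matrix.mulVec_mulVec _ (R t) (Rx P), rotation_cross (Rx_mem_rotation P),
      inv_twistInertia hJ]
    simp only [Matrix.mulVec_mulVec, Matrix.transpose_mul, Matrix.mul_assoc]

section FreeMotion

variable {J ell : Fin 3 → ℝ} {R : ℝ → Matrix (Fin 3) (Fin 3) ℝ}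

theorem hasDerivAt_dotProduct_const {w : ℝ → Fin 3 → ℝ} {w' : Fin 3 → ℝ} {t : ℝ}
    (hw : HasDerivAt w w' t) (v : Fin 3 → ℝ) :
    HasDerivAt (fun s => w s ⬝ᵥ v) (w' ⬝ᵥ v) t := by
  have := hasDerivAt_pi.1 hw
  simp only [dotProduct, Fin.sum_univ_three]
  exact (((this 0).mul_const _).add ((this 1).mul_const _)).add ((this 2).mul_const _)

/-- The Euler equation. -/
theorem IsFreeMotion.hasDerivAt_momentum {I : Matrix (Fin 3) (Fin 3) ℝ}
    (H : IsFreeMotion I ell R) (t : ℝ) :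
    HasDerivAt (fun s => (R s)ᵀ *ᵥ ell)
      (crossProduct ((R t)ᵀ *ᵥ ell) (I⁻¹ *ᵥ ((R t)ᵀ *ᵥ ell))) t := by
  have hcomp : ∀ (w : Fin 3 → ℝ) (i : Fin 3), w i = w ⬝ᵥ (Pi.single i 1) := fun w i => by simp
  refine hasDerivAt_pi.2 fun i => ?_
  have h := hasDerivAt_dotProduct_const (H.velocity t (Pi.single i 1)) ell
  have h1 : (fun s => ((R s)ᵀ *ᵥ ell) i) = fun s => (R s *ᵥ Pi.single i 1) ⬝ᵥ ell := by
    ext s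
    rw [hcomp ((R s)ᵀ *ᵥ ell), dotProduct_comm _ ell, dotProduct_mulVec_eq]
  rw [h1]
  refine h.congr_deriv ?_
  rw [hcomp (crossProduct _ _), dotProduct_comm _ ell, dotProduct_mulVec_eq,
    triple_product_permutation, triple_product_permutation, dotProduct_comm]

theorem IsFreeMotion.dotProduct_momentum {I : Matrix (Fin 3) (Fin 3) ℝ}
    (H : IsFreeMotion I ell R) (t : ℝ) :
    ((R t)ᵀ *ᵥ ell) ⬝ᵥ ((R t)ᵀ *ᵥ ell) = ell ⬝ᵥ ell :=
  rotation_dotProduct (transpose_mem_rotation (H.rotation t)) _ _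

theorem IsFreeMotion.euler (hJ : ∀ i, 0 < J i) (H : IsFreeMotion (Matrix.diagonal J) ell R)
    {L : ℝ → Fin 3 → ℝ} (hL : ∀ t, L t = (R t)ᵀ *ᵥ ell) (t : ℝ) :
    HasDerivAt (fun s => L s 0) (((J 2)⁻¹ - (J 1)⁻¹) * (L t 1 * L t 2)) t ∧
    HasDerivAt (fun s => L s 1) (((J 0)⁻¹ - (J 2)⁻¹) * (L t 0 * L t 2)) t ∧
    HasDerivAt (fun s => L s 2) (((J 1)⁻¹ - (J 0)⁻¹) * (L t 0 * L t 1)) t := by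
  obtain rfl : L = fun t => (R t)ᵀ *ᵥ ell := funext hL
  have h := hasDerivAt_pi.1 (H.hasDerivAt_momentum t)
  rw [inv_diagonal hJ] at h
  refine ⟨(h 0).congr_deriv ?_, (h 1).congr_deriv ?_, (h 2).congr_deriv ?_⟩ <;>
    · simp only [cross_apply, Matrix.mulVec_diagonal, Matrix.cons_val]
      ring

/-- A rotation about the second principal axis is steady. -/
theorem IsFreeMotion.steady (hJ : ∀ i, 0 < J i) (H : IsFreeMotion (Matrix.diagonal J) ell R)
    {l : ℝ} (h0 : (R 0)ᵀ *ᵥ ell = ![0, l, 0]) (t : ℝ) : (R t)ᵀ *ᵥ ell = ![0, l, 0] := by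
  set L : ℝ → Fin 3 → ℝ := fun t => (R t)ᵀ *ᵥ ell with hL
  have hE := H.euler hJ (L := L) fun _ => rfl
  have hsq : ∀ t, L t 0 ^ 2 + L t 1 ^ 2 + L t 2 ^ 2 = l ^ 2 := fun t => by
    have h1 : L t ⬝ᵥ L t = L 0 ⬝ᵥ L 0 :=
      (H.dotProduct_momentum t).trans (H.dotProduct_momentum 0).symm
    rw [show L 0 = ![0, l, 0] from h0] at h1
    simp [dotProduct, Fin.sum_univ_three] at h1
    linarith
  set κ : ℝ := (J 2)⁻¹ - (J 0)⁻¹ with hκ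
  -- Grönwall argument: f is the squared distance from the second axis, |f'| ≤ |κ| |l| f and f(0) =
  -- 0. Exponential factors with opposite signs handle positive and negative times.
  set f : ℝ → ℝ := fun t => L t 0 ^ 2 + L t 2 ^ 2 with hf
  have hf' : ∀ t, HasDerivAt f (2 * κ * (L t 0 * L t 1 * L t 2)) t := fun t => by
    obtain ⟨e0, -, e2⟩ := hE t
    refine ((e0.pow 2).add (e2.pow 2)).congr_deriv ?_
    simp only [hκ]
    ring
  have hf0 : f 0 = 0 := by
    simp only [hf]
    rw [show L 0 = ![0, l, 0] from h0]
    simp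
  have hbound : ∀ t, |2 * κ * (L t 0 * L t 1 * L t 2)| ≤ |κ| * |l| * f t := fun t => by
    have h1 : |L t 1| ≤ |l| := sq_le_sq.1 (by
      nlinarith [hsq t, sq_nonneg (L t 0), sq_nonneg (L t 2)])
    have h2 : 2 * (|L t 0| * |L t 2|) ≤ f t := by
      have := two_mul_le_add_sq |L t 0| |L t 2|
      rw [sq_abs, sq_abs] at this
      simp only [hf]
      linarith
    calc |2 * κ * (L t 0 * L t 1 * L t 2)|
        = |κ| * |L t 1| * (2 * (|L t 0| * |L t 2|)) := by
          rw [abs_mul, abs_mul, abs_mul, abs_mul, abs_two]; ring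
      _ ≤ |κ| * |l| * f t :=
          mul_le_mul (mul_le_mul_of_nonneg_left h1 (abs_nonneg _)) h2 (by positivity)
            (by positivity)
  have hft : ∀ t, f t ≤ 0 := fun t => by
    rcases le_total 0 t with ht | ht
    · have hd : ∀ t, HasDerivAt (fun t => f t * exp (-(|κ| * |l|) * t))
          ((2 * κ * (L t 0 * L t 1 * L t 2) - |κ| * |l| * f t) * exp (-(|κ| * |l|) * t)) t :=
        fun t => ((hf' t).mul ((hasDerivAt_id t).const_mul (-(|κ| * |l|))).exp).congr_deriv (by
          simp only [id]; ring)
      have := antitone_of_hasDerivAt_nonpos hd (fun t => mul_nonpos_of_nonpos_of_nonneg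
        (by have := (abs_le.1 (hbound t)).2; linarith)
        (exp_pos _).le) ht
      simp only [hf0, zero_mul] at this
      exact nonpos_of_mul_nonpos_left this (exp_pos _)
    · have hd : ∀ t, HasDerivAt (fun t => f t * exp (|κ| * |l| * t))
          ((2 * κ * (L t 0 * L t 1 * L t 2) + |κ| * |l| * f t) * exp (|κ| * |l| * t)) t :=
        fun t => ((hf' t).mul ((hasDerivAt_id t).const_mul (|κ| * |l|)).exp).congr_deriv (by
          simp only [id]; ring)
      have := monotone_of_hasDerivAt_nonneg hd (fun t => mul_nonneg
        (by have := (abs_le.1 (hbound t)).1; linarith) (exp_pos _).le) ht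
      simp only [hf0, zero_mul] at this
      exact nonpos_of_mul_nonpos_left this (exp_pos _)
  have h0t : ∀ t, L t 0 = 0 := fun t => by
    have := hft t
    simp only [hf] at this
    exact pow_eq_zero_iff (two_ne_zero) |>.1
      (le_antisymm (by linarith [sq_nonneg (L t 2)]) (sq_nonneg _))
  have h2t : ∀ t, L t 2 = 0 := fun t => by
    have := hft t
    simp only [hf] at this
    exact pow_eq_zero_iff (two_ne_zero) |>.1
      (le_antisymm (by linarith [sq_nonneg (L t 0)]) (sq_nonneg _))
  have h1t : L t 1 = L 0 1 :=
    is_const_of_deriv_eq_zero (f := fun t => L t 1) (fun t => (hE t).2.1.differentiableAt)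
      (fun t => by rw [(hE t).2.1.deriv, h0t]; ring) t 0
  ext i
  change L t i = _
  fin_cases i
  · simpa using h0t t
  · simp only [Fin.mk_one, Fin.isValue, h1t]
    rw [show L 0 = ![0, l, 0] from h0]
  · simpa using h2t t

end FreeMotion

/-! ### Angles about the angular momentum -/

/-- `(a, b, ell / l)` is a positively oriented orthonormal frame. -/
structure IsFrame (l : ℝ) (ell a b : Fin 3 → ℝ) : Prop where
  unit : a ⬝ᵥ a = 1
  orthogonal : a ⬝ᵥ ell = 0
  cross : l • b = crossProduct ell a

section Angle

variable {l : ℝ} {ell a b : Fin 3 → ℝ}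

theorem exists_isFrame (hl : 0 < l) : ∃ a b, IsFrame l ell a b := by
  obtain ⟨a, h1, h2⟩ : ∃ a : Fin 3 → ℝ, a ⬝ᵥ a = 1 ∧ a ⬝ᵥ ell = 0 := by
    rcases (add_nonneg (sq_nonneg (ell 0)) (sq_nonneg (ell 1))).lt_or_eq with h | h
    · set r := √(ell 0 ^ 2 + ell 1 ^ 2)
      have hr : r ^ 2 = ell 0 ^ 2 + ell 1 ^ 2 := Real.sq_sqrt h.le
      have hr0 : r ≠ 0 := (Real.sqrt_pos.2 h).ne'
      refine ⟨![-ell 1 / r, ell 0 / r, 0], ?_, ?_⟩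
      · simp only [dotProduct, Fin.sum_univ_three, Matrix.cons_val]
        field_simp
        linarith
      · simp only [dotProduct, Fin.sum_univ_three, Matrix.cons_val]
        field_simp
        ring
    · have h0 : ell 0 = 0 := by nlinarith [sq_nonneg (ell 0), sq_nonneg (ell 1)]
      exact ⟨![1, 0, 0], by simp [dotProduct, Fin.sum_univ_three],
        by simp [dotProduct, Fin.sum_univ_three, h0]⟩
  exact ⟨a, l⁻¹ • crossProduct ell a, h1, h2, by rw [smul_smul, mul_inv_cancel₀ hl.ne', one_smul]⟩

theorem IsFrame.relations (F : IsFrame l ell a b) (hl : 0 < l) (hell : ell ⬝ᵥ ell = l ^ 2) :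
    b ⬝ᵥ b = 1 ∧ a ⬝ᵥ b = 0 ∧ b ⬝ᵥ ell = 0 ∧ l • crossProduct a b = ell := by
  have hl2 : l ^ 2 ≠ 0 := (pow_pos hl 2).ne'
  have hla : ell ⬝ᵥ a = 0 := by rw [dotProduct_comm, F.orthogonal]
  refine ⟨?_, ?_, ?_, ?_⟩
  · refine mul_left_cancel₀ hl2 ?_
    have : (l • b) ⬝ᵥ (l • b) = l ^ 2 := by
      rw [F.cross, cross_dot_cross, hell, F.unit, F.orthogonal, hla]; ring
    rw [smul_dotProduct, dotProduct_smul, smul_eq_mul, smul_eq_mul] at this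
    linarith
  · refine mul_left_cancel₀ hl.ne' ?_
    rw [mul_zero, ← smul_eq_mul, ← dotProduct_smul, F.cross, dot_cross_self]
  · refine mul_left_cancel₀ hl.ne' ?_
    rw [mul_zero, ← smul_eq_mul, ← smul_dotProduct, F.cross, dotProduct_comm, dot_self_cross]
  · rw [← map_smul, F.cross, cross_cross_eq_smul_sub_smul', F.unit, hla]
    simp

/-- The matrix with rows a, b, ell/l satisfies A Aᵀ = 1, and therefore also Aᵀ A = 1. -/
theorem IsFrame.expansion (F : IsFrame l ell a b) (hl : 0 < l) (hell : ell ⬝ᵥ ell = l ^ 2)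
    (w : Fin 3 → ℝ) :
    w = (w ⬝ᵥ a) • a + (w ⬝ᵥ b) • b + ((w ⬝ᵥ ell) / l ^ 2) • ell := by
  obtain ⟨hbb, hab, hbl, hcross⟩ := F.relations hl hell
  have hl2 : l ^ 2 ≠ 0 := (pow_pos hl 2).ne'
  set A : Matrix (Fin 3) (Fin 3) ℝ := Matrix.of ![a, b, l⁻¹ • ell] with hA
  have hAA : A * Aᵀ = 1 := by
    have e : ∀ i j, (A * Aᵀ) i j = A i ⬝ᵥ A j := fun i j => rfl
    have c1 : ell ⬝ᵥ a = 0 := by rw [dotProduct_comm, F.orthogonal]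
    have c2 : ell ⬝ᵥ b = 0 := by rw [dotProduct_comm, hbl]
    have c3 : b ⬝ᵥ a = 0 := by rw [dotProduct_comm, hab]
    have r0 : A 0 = a := rfl
    have r1 : A 1 = b := rfl
    have r2 : A 2 = l⁻¹ • ell := rfl
    have hll : l⁻¹ * (l⁻¹ * l ^ 2) = 1 := by field_simp
    ext i j
    rw [e]
    fin_cases i <;> fin_cases j <;>
      simp [r0, r1, r2, F.unit, F.orthogonal, hbb, hab, hbl, hell, hll, c1, c2, c3]
  have h1 : Aᵀ *ᵥ (A *ᵥ w) = w := by
    rw [Matrix.mulVec_mulVec, mul_eq_one_comm.1 hAA, Matrix.one_mulVec]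
  conv_lhs => rw [← h1]
  ext i
  simp only [hA, Matrix.mulVec, dotProduct, Fin.sum_univ_three, Matrix.transpose_apply,
    Matrix.of_apply, Matrix.cons_val, Pi.add_apply, Pi.smul_apply, smul_eq_mul]
  field_simp

variable {w w' : ℝ → Fin 3 → ℝ} {k : ℝ → ℝ}

/-- For p = w·a and q = w·b, the expressions in `hpos` and `h` are frame-free forms of l²(p² + q²)
and l²(p q' - q p'). This reduces the claim to plane polar coordinates. -/
theorem IsFrame.exists_polar_lift (F : IsFrame l ell a b) (hl : 0 < l)
    (hell : ell ⬝ᵥ ell = l ^ 2) (hw : ∀ t, HasDerivAt w (w' t) t) (hk : Continuous k)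
    (hpos : ∀ t, (w t ⬝ᵥ ell) ^ 2 < l ^ 2 * (w t ⬝ᵥ w t))
    (h : ∀ t, l * (ell ⬝ᵥ crossProduct (w t) (w' t)) =
      k t * (l ^ 2 * (w t ⬝ᵥ w t) - (w t ⬝ᵥ ell) ^ 2)) :
    ∃ φ ρ : ℝ → ℝ, (∀ t, HasDerivAt φ (k t) t) ∧ ∀ t, 0 < ρ t ∧
      w t ⬝ᵥ a = ρ t * cos (φ t) ∧ w t ⬝ᵥ b = ρ t * sin (φ t) := by
  obtain ⟨hbb, hab, hbl, hcross⟩ := F.relations hl hell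
  have hl2 : 0 < l ^ 2 := pow_pos hl 2
  have hsq : ∀ t, l ^ 2 * ((w t ⬝ᵥ a) ^ 2 + (w t ⬝ᵥ b) ^ 2) =
      l ^ 2 * (w t ⬝ᵥ w t) - (w t ⬝ᵥ ell) ^ 2 := fun t => by
    have e : w t ⬝ᵥ w t = w t ⬝ᵥ
      ((w t ⬝ᵥ a) • a + (w t ⬝ᵥ b) • b + ((w t ⬝ᵥ ell) / l ^ 2) • ell) := by
        rw [← F.expansion hl hell]
    simp only [dotProduct_add, dotProduct_smul, smul_eq_mul] at e
    rw [e]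
    field_simp
    ring
  have hpos' : ∀ t, 0 < (w t ⬝ᵥ a) ^ 2 + (w t ⬝ᵥ b) ^ 2 := fun t => by
    have := hsq t
    have := hpos t
    exact pos_of_mul_pos_right (by linarith) hl2.le
  obtain ⟨φ, h1, h2⟩ := TwistingSomersault.exists_polar_lift
    (fun t => hasDerivAt_dotProduct_const (hw t) a)
    (fun t => hasDerivAt_dotProduct_const (hw t) b) hk hpos' (fun t => by
      have e := cross_dot_cross (w t) (w' t) a b
      refine mul_left_cancel₀ hl2.ne' ?_
      have e2 := h t
      rw [← hsq, ← hcross, smul_dotProduct, dotProduct_comm, e, smul_eq_mul] at e2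
      linear_combination e2)
  exact ⟨φ, _, h1, fun t => ⟨Real.sqrt_pos.2 (hpos' t), h2 t⟩⟩

theorem exists_isAngleAbout (hl : 0 < l) (hell : ell ⬝ᵥ ell = l ^ 2)
    (hw : ∀ t, HasDerivAt w (w' t) t) (hk : Continuous k)
    (hpos : ∀ t, (w t ⬝ᵥ ell) ^ 2 < l ^ 2 * (w t ⬝ᵥ w t))
    (h : ∀ t, l * (ell ⬝ᵥ crossProduct (w t) (w' t)) =
      k t * (l ^ 2 * (w t ⬝ᵥ w t) - (w t ⬝ᵥ ell) ^ 2)) :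
    ∃ φ, IsAngleAbout ell w φ := by
  obtain ⟨a, b, F⟩ := exists_isFrame hl
  obtain ⟨φ, ρ, h1, h2⟩ := F.exists_polar_lift hl hell hw hk hpos h
  refine ⟨φ, continuous_iff_continuousAt.2 fun t => (h1 t).continuousAt, a, b, F.unit,
    F.orthogonal, ?_, fun t => ⟨ρ t, (w t ⬝ᵥ ell) / l ^ 2, (h2 t).1, ?_⟩⟩
  · rw [hell, Real.sqrt_sq hl.le, F.cross]
  · conv_lhs => rw [F.expansion hl hell (w t)]
    rw [(h2 t).2.1, (h2 t).2.2, smul_add, smul_smul, smul_smul]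

/-- In the frame that belongs to φ, the angle φ and the differentiable polar lift ψ differ by a
multiple of 2π at each time. By continuity that multiple is constant. Hence the amount of rotation
does not depend on the chosen angle or frame. -/
theorem IsAngleAbout.hasDerivAt {φ : ℝ → ℝ} (hφ : IsAngleAbout ell w φ) (hl : 0 < l)
    (hell : ell ⬝ᵥ ell = l ^ 2)
    (hw : ∀ t, HasDerivAt w (w' t) t) (hk : Continuous k)
    (hpos : ∀ t, (w t ⬝ᵥ ell) ^ 2 < l ^ 2 * (w t ⬝ᵥ w t))
    (h : ∀ t, l * (ell ⬝ᵥ crossProduct (w t) (w' t)) =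
      k t * (l ^ 2 * (w t ⬝ᵥ w t) - (w t ⬝ᵥ ell) ^ 2)) (t : ℝ) :
    HasDerivAt φ (k t) t := by
  obtain ⟨hcont, a, b, h1, h2, h3, hr⟩ := hφ
  have F : IsFrame l ell a b := ⟨h1, h2, by rw [← h3, hell, Real.sqrt_sq hl.le]⟩
  obtain ⟨hbb, hab, hbl, hcross⟩ := F.relations hl hell
  have c1 : ell ⬝ᵥ a = 0 := by rw [dotProduct_comm, F.orthogonal]
  have c2 : ell ⬝ᵥ b = 0 := by rw [dotProduct_comm, hbl]
  have c3 : b ⬝ᵥ a = 0 := by rw [dotProduct_comm, hab]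
  obtain ⟨ψ, ρ, hψ, hρ⟩ := F.exists_polar_lift hl hell hw hk hpos h
  have hcos : ∀ t, cos (φ t - ψ t) = 1 := fun t => by
    obtain ⟨r, c, hr0, hwt⟩ := hr t
    obtain ⟨hρ0, e1, e2⟩ := hρ t
    have f1 : w t ⬝ᵥ a = r * cos (φ t) := by
      rw [hwt]
      simp [add_dotProduct, smul_dotProduct, h1, c1, c3]
    have f2 : w t ⬝ᵥ b = r * sin (φ t) := by
      rw [hwt]
      simp [add_dotProduct, smul_dotProduct, hbb, hab, c2]
    rw [f1] at e1
    rw [f2] at e2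
    have i1 := cos_sq_add_sin_sq (φ t)
    have i2 := cos_sq_add_sin_sq (ψ t)
    have hrr : r = ρ t := by
      have : r ^ 2 = ρ t ^ 2 := by
        linear_combination (-(r ^ 2)) * i1 + ρ t ^ 2 * i2 +
          (r * cos (φ t) + ρ t * cos (ψ t)) * e1 + (r * sin (φ t) + ρ t * sin (ψ t)) * e2
      exact (pow_left_inj₀ hr0.le hρ0.le two_ne_zero).1 this
    rw [← hrr] at e1 e2
    rw [cos_sub, mul_left_cancel₀ hr0.ne' e1, mul_left_cancel₀ hr0.ne' e2]
    linear_combination i2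
  have hψc : Continuous ψ := continuous_iff_continuousAt.2 fun t => (hψ t).continuousAt
  have hconst : ∀ s, φ s = ψ s + (φ 0 - ψ 0) := fun s => by
    have := eq_of_continuous_of_cos_eq_one (hcont.sub hψc) hcos s 0
    simp only [Pi.sub_apply] at this
    linarith
  rw [show φ = fun s => ψ s + (φ 0 - ψ 0) from funext hconst]
  exact (hψ t).add_const _

end Angle

section AxisAngle

variable {J ell : Fin 3 → ℝ} {R : ℝ → Matrix (Fin 3) (Fin 3) ℝ} {l : ℝ} {L : ℝ → Fin 3 → ℝ}
  {k : ℝ → ℝ}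

/-- Rotated back to the body frame, the first identity reads L·(e_z × (Ω × e_z)) = L_x Ω_x + L_y
Ω_y, and the second |L|² - L_z² = L_x² + L_y². -/
theorem IsFreeMotion.axis_identities (hJ : ∀ i, 0 < J i)
    (H : IsFreeMotion (Matrix.diagonal J) ell R) (hell : ell ⬝ᵥ ell = l ^ 2)
    (hL : ∀ t, L t = (R t)ᵀ *ᵥ ell) (t : ℝ) :
    ell ⬝ᵥ crossProduct (R t *ᵥ ![0, 0, 1])
        (R t *ᵥ crossProduct ((Matrix.diagonal J)⁻¹ *ᵥ ((R t)ᵀ *ᵥ ell)) ![0, 0, 1]) =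
      (J 0)⁻¹ * L t 0 ^ 2 + (J 1)⁻¹ * L t 1 ^ 2 ∧
    l ^ 2 * ((R t *ᵥ ![0, 0, 1]) ⬝ᵥ (R t *ᵥ ![0, 0, 1])) - ((R t *ᵥ ![0, 0, 1]) ⬝ᵥ ell) ^ 2 =
      L t 0 ^ 2 + L t 1 ^ 2 := by
  have hsq := H.dotProduct_momentum t
  rw [← hL, hell] at hsq
  rw [← rotation_cross (H.rotation t), dotProduct_mulVec_eq, rotation_dotProduct (H.rotation t),
    dotProduct_comm _ ell, dotProduct_mulVec_eq, ← hL, inv_diagonal hJ, ← hsq]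
  constructor
  · simp only [cross_apply, Matrix.mulVec_diagonal, Matrix.cons_val, dotProduct,
      Fin.sum_univ_three]
    ring
  · simp only [Matrix.cons_val, dotProduct, Fin.sum_univ_three]
    ring

/-- The angle about the angular momentum of the third principal axis of a free rigid body
exists, and its derivative is determined. -/
theorem IsFreeMotion.axis_angle (hJ : ∀ i, 0 < J i)
    (H : IsFreeMotion (Matrix.diagonal J) ell R) (hl : 0 < l) (hell : ell ⬝ᵥ ell = l ^ 2)
    (hL : ∀ t, L t = (R t)ᵀ *ᵥ ell) (hk : Continuous k)
    (hpos : ∀ t, 0 < L t 0 ^ 2 + L t 1 ^ 2)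
    (h : ∀ t, l * ((J 0)⁻¹ * L t 0 ^ 2 + (J 1)⁻¹ * L t 1 ^ 2) =
      k t * (L t 0 ^ 2 + L t 1 ^ 2)) :
    (∃ φ, IsAngleAbout ell (fun t => R t *ᵥ ![0, 0, 1]) φ) ∧
    ∀ φ, IsAngleAbout ell (fun t => R t *ᵥ ![0, 0, 1]) φ → ∀ t, HasDerivAt φ (k t) t := by
  have A := H.axis_identities hJ hell hL
  have h1 : ∀ t, ((R t *ᵥ ![0, 0, 1]) ⬝ᵥ ell) ^ 2 <
      l ^ 2 * ((R t *ᵥ ![0, 0, 1]) ⬝ᵥ (R t *ᵥ ![0, 0, 1])) := fun t => by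
    have := (A t).2
    have := hpos t
    linarith
  have h2 : ∀ t, l * (ell ⬝ᵥ crossProduct (R t *ᵥ ![0, 0, 1])
        (R t *ᵥ crossProduct ((Matrix.diagonal J)⁻¹ *ᵥ ((R t)ᵀ *ᵥ ell)) ![0, 0, 1])) =
      k t * (l ^ 2 * ((R t *ᵥ ![0, 0, 1]) ⬝ᵥ (R t *ᵥ ![0, 0, 1])) -
        ((R t *ᵥ ![0, 0, 1]) ⬝ᵥ ell) ^ 2) := fun t => by
    rw [(A t).1, (A t).2, h t]
  exact ⟨exists_isAngleAbout hl hell (fun t => H.velocity t _) hk h1 h2,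
    fun φ hφ => hφ.hasDerivAt hl hell (fun t => H.velocity t _) hk h1 h2⟩

/-- In a steady rotation about the second principal axis, the third one has an angle. -/
theorem IsFreeMotion.exists_steady_angle (hJ : ∀ i, 0 < J i)
    (H : IsFreeMotion (Matrix.diagonal J) ell R) (hl : 0 < l) (hell : ell ⬝ᵥ ell = l ^ 2)
    (h0 : (R 0)ᵀ *ᵥ ell = ![0, l, 0]) :
    ∃ φ, IsAngleAbout ell (fun t => R t *ᵥ ![0, 0, 1]) φ :=
  (H.axis_angle hJ hl hell (L := fun _ => ![0, l, 0]) (fun t => (H.steady hJ h0 t).symm)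
    (k := fun _ => l * (J 1)⁻¹) continuous_const (fun t => by simp [pow_pos hl 2])
    (fun t => by simp; ring)).1

end AxisAngle

open MeasureTheory Set

/-! ### The area of the slice -/

/-- The case B ≤ A is included: the set is empty and `ENNReal.ofReal` truncates to 0.
`lintegral_parabola` relies on this truncation beyond y = Z. -/
theorem lintegral_annulus {A B : ℝ} (hA : 0 ≤ A) :
    ∫⁻ r in Ioi (0 : ℝ), {r : ℝ | A ≤ r ^ 2 ∧ r ^ 2 < B}.indicator (fun r => ENNReal.ofReal r) r =
      ENNReal.ofReal ((B - A) / 2) := by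
  have hm1 : MeasurableSet {r : ℝ | A ≤ r ^ 2} := measurableSet_le (by fun_prop) (by fun_prop)
  have hm2 : MeasurableSet {r : ℝ | r ^ 2 < B} := measurableSet_lt (by fun_prop) (by fun_prop)
  have hm : MeasurableSet {r : ℝ | A ≤ r ^ 2 ∧ r ^ 2 < B} := hm1.inter hm2
  rw [setLIntegral_indicator hm]
  rcases le_total B A with h | h
  · have : {r : ℝ | A ≤ r ^ 2 ∧ r ^ 2 < B} ∩ Ioi 0 = ∅ := by
      ext r
      simp only [mem_inter_iff, mem_ofPred_eq, mem_empty_iff_false, iff_false]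
      rintro ⟨⟨h1, h2⟩, -⟩
      linarith
    rw [this, setLIntegral_empty, ENNReal.ofReal_of_nonpos (by linarith)]
  · have hB : 0 ≤ B := hA.trans h
    have hsub : Ioo √A √B ⊆ {r : ℝ | A ≤ r ^ 2 ∧ r ^ 2 < B} ∩ Ioi 0 := fun r hr =>
      ⟨⟨((Real.sqrt_lt' ((sqrt_nonneg A).trans_lt hr.1)).1 hr.1).le,
        (Real.lt_sqrt ((sqrt_nonneg A).trans hr.1.le)).1 hr.2⟩, (sqrt_nonneg A).trans_lt hr.1⟩
    have hsup : {r : ℝ | A ≤ r ^ 2 ∧ r ^ 2 < B} ∩ Ioi 0 ⊆ Icc √A √B := fun r hr =>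
      ⟨(Real.sqrt_le_left (le_of_lt hr.2)).2 hr.1.1, Real.le_sqrt_of_sq_le hr.1.2.le⟩
    have hae : ({r : ℝ | A ≤ r ^ 2 ∧ r ^ 2 < B} ∩ Ioi 0 : Set ℝ) =ᵐ[volume] Ioc √A √B :=
      (((LE.le.eventuallyLE hsup).trans Ioo_ae_eq_Icc.symm.le).antisymm
        (LE.le.eventuallyLE hsub)).trans Ioo_ae_eq_Ioc
    rw [setLIntegral_congr hae, ← ofReal_integral_eq_lintegral_ofReal,
      ← intervalIntegral.integral_of_le (Real.sqrt_le_sqrt h), integral_id, Real.sq_sqrt hA,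
      Real.sq_sqrt hB]
    · exact (continuous_id.intervalIntegrable _ _).1
    · exact (ae_restrict_mem measurableSet_Ioc).mono fun r hr => (sqrt_nonneg A).trans hr.1.le

theorem lintegral_parabola {Z : ℝ} (hZ : 0 < Z) :
    ∫⁻ y in Ici (0 : ℝ), ENNReal.ofReal ((1 - y ^ 2 / Z ^ 2) / 2) = ENNReal.ofReal (Z / 3) := by
  have hsplit : Ici (0 : ℝ) = Icc 0 Z ∪ Ioi Z := (Icc_union_Ioi_eq_Ici hZ.le).symm
  have hz : ∫⁻ y in Ioi Z, ENNReal.ofReal ((1 - y ^ 2 / Z ^ 2) / 2) = 0 := by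
    rw [setLIntegral_congr_fun (g := fun _ => 0) measurableSet_Ioi, lintegral_zero]
    intro y hy
    refine ENNReal.ofReal_of_nonpos ?_
    have : 1 ≤ y ^ 2 / Z ^ 2 := by
      rw [one_le_div (by positivity)]
      exact pow_le_pow_left₀ hZ.le (le_of_lt hy) 2
    linarith
  rw [hsplit, lintegral_union measurableSet_Ioi, hz, add_zero,
    setLIntegral_congr Ioc_ae_eq_Icc.symm, ← ofReal_integral_eq_lintegral_ofReal, ← intervalIntegral.integral_of_le hZ.le]
  · congr 1
    rw [intervalIntegral.integral_div, intervalIntegral.integral_sub (by simp)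
      (Continuous.intervalIntegrable (by fun_prop) _ _), intervalIntegral.integral_div]
    simp only [intervalIntegral.integral_const, integral_pow, smul_eq_mul]
    field_simp
    ring
  · exact (Continuous.intervalIntegrable (by fun_prop) 0 Z).1
  · refine (ae_restrict_mem measurableSet_Ioc).mono fun y hy => ?_
    have : y ^ 2 / Z ^ 2 ≤ 1 := by
      rw [div_le_one (by positivity)]
      exact pow_le_pow_left₀ hy.1.le hy.2 2
    simp only [Pi.zero_apply]
    linarith
  · rw [disjoint_left]
    intro y hy hy'
    exact absurd hy.2 (not_le.2 hy')

theorem lintegral_parabola_sign {Z s : ℝ} (hZ : 0 < Z) (hs : s = 1 ∨ s = -1) :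
    ∫⁻ y, {y : ℝ | 0 ≤ s * y}.indicator
      (fun y => ENNReal.ofReal ((1 - y ^ 2 / Z ^ 2) / 2)) y = ENNReal.ofReal (Z / 3) := by
  have h1 : ∫⁻ y, {y : ℝ | 0 ≤ y}.indicator
      (fun y => ENNReal.ofReal ((1 - y ^ 2 / Z ^ 2) / 2)) y = ENNReal.ofReal (Z / 3) := by
    rw [← lintegral_parabola hZ, ← lintegral_indicator measurableSet_Ici]
    rfl
  rcases hs with rfl | rfl
  · simpa only [one_mul] using h1
  · rw [← h1, ← lintegral_neg_eq_self]
    refine lintegral_congr fun y => ?_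
    simp [indicator]

/-- The part of the solid unit ball over the slice of the sphere on the side `s` of the equator,
with energy at most `h / 2`. -/
def solidSlice (a b c h s : ℝ) : Set (ℝ × ℝ × ℝ) :=
  {v | (c - h) * v.1 ^ 2 ≤ (h - a) * v.2.1 ^ 2 + (h - b) * v.2.2 ^ 2 ∧ 0 ≤ s * v.1 ∧
    0 < v.2.1 ^ 2 + v.2.2 ^ 2 + v.1 ^ 2 ∧ v.2.1 ^ 2 + v.2.2 ^ 2 + v.1 ^ 2 < 1}

theorem measurableSet_solidSlice (a b c h s : ℝ) : MeasurableSet (solidSlice a b c h s) := by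
  have h1 : MeasurableSet {v : ℝ × ℝ × ℝ |
      (c - h) * v.1 ^ 2 ≤ (h - a) * v.2.1 ^ 2 + (h - b) * v.2.2 ^ 2} :=
    measurableSet_le (by fun_prop) (by fun_prop)
  have h2 : MeasurableSet {v : ℝ × ℝ × ℝ | 0 ≤ s * v.1} :=
    measurableSet_le (by fun_prop) (by fun_prop)
  have h3 : MeasurableSet {v : ℝ × ℝ × ℝ | 0 < v.2.1 ^ 2 + v.2.2 ^ 2 + v.1 ^ 2} :=
    measurableSet_lt (by fun_prop) (by fun_prop)
  have h4 : MeasurableSet {v : ℝ × ℝ × ℝ | v.2.1 ^ 2 + v.2.2 ^ 2 + v.1 ^ 2 < 1} :=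
    measurableSet_lt (by fun_prop) (by fun_prop)
  exact h1.inter (h2.inter (h3.inter h4))

section

variable {a b c h s : ℝ}

/-- In polar coordinates of the horizontal plane at height y, the solid is cut out at each longitude
by a lower bound on r² from the energy and the upper bound 1 - y² from the ball. -/
theorem volume_solidSlice_section (ha : a < h) (hb : b < h) (hc : h < c) (y : ℝ) :
    volume (Prod.mk y ⁻¹' solidSlice a b c h s) =
      ∫⁻ x in Ioo (-π) π, {y : ℝ | 0 ≤ s * y}.indicator
        (fun y => ENNReal.ofReal ((1 - y ^ 2 / height a b c h x ^ 2) / 2)) y := by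
  have hm : MeasurableSet (Prod.mk y ⁻¹' solidSlice a b c h s) :=
    measurable_prodMk_left (measurableSet_solidSlice a b c h s)
  have hmf : Measurable fun p : ℝ × ℝ => ENNReal.ofReal p.1 •
      (Prod.mk y ⁻¹' solidSlice a b c h s).indicator (fun _ => (1 : ENNReal))
        (polarCoord.symm p) := by
    refine Measurable.smul (ENNReal.measurable_ofReal.comp measurable_fst) ?_
    exact (measurable_const.indicator hm).comp continuous_polarCoord_symm.measurable
  rw [← lintegral_indicator_one hm]
  change ∫⁻ p, (Prod.mk y ⁻¹' solidSlice a b c h s).indicator (fun _ => (1 : ENNReal)) p = _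
  rw [← lintegral_comp_polarCoord_symm, polarCoord_target, Measure.volume_eq_prod,
    ← Measure.prod_restrict, lintegral_prod_symm _ hmf.aemeasurable]
  refine lintegral_congr fun x => ?_
  have hg := transverse_lt ha hb x
  have hcg : 0 < (c - h) / (h - transverse a b x) := div_pos (by linarith) (by linarith)
  have hhsq := height_sq_mul ha hb hc x
  have hhpos := height_pos ha hb hc x
  by_cases hy : 0 ≤ s * y
  · rw [indicator_of_mem (show y ∈ {y : ℝ | 0 ≤ s * y} from hy),
      -- The two bounds on r² match because (c - h)/(h - g) = 1/`height`² - 1.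
      show (1 - y ^ 2 / height a b c h x ^ 2) =
        (1 - y ^ 2) - y ^ 2 * ((c - h) / (h - transverse a b x)) by
          rw [← hhsq]
          have : c - transverse a b x ≠ 0 := by linarith
          field_simp
          linear_combination y ^ 2 * hhsq,
      ← lintegral_annulus (by positivity)]
    refine setLIntegral_congr_fun measurableSet_Ioi fun r hr => ?_
    have hr : 0 < r := hr
    have hiff : polarCoord.symm (r, x) ∈ Prod.mk y ⁻¹' solidSlice a b c h s ↔
        r ∈ {r : ℝ | y ^ 2 * ((c - h) / (h - transverse a b x)) ≤ r ^ 2 ∧ r ^ 2 < 1 - y ^ 2} := by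
      have e := cos_sq_add_sin_sq x
      have e1 : (r * cos x) ^ 2 + (r * sin x) ^ 2 = r ^ 2 := by linear_combination r ^ 2 * e
      have e2 : (h - a) * (r * cos x) ^ 2 + (h - b) * (r * sin x) ^ 2 =
          r ^ 2 * (h - transverse a b x) := by
        unfold transverse; linear_combination h * r ^ 2 * e
      simp only [polarCoord_symm_apply, solidSlice, mem_preimage, mem_ofPred_eq, e1, e2]
      rw [← mul_div_assoc, div_le_iff₀ (by linarith), mul_comm (y ^ 2)]
      constructor
      · rintro ⟨h1, -, -, h2⟩
        exact ⟨h1, by linarith⟩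
      · rintro ⟨h1, h2⟩
        exact ⟨h1, hy, by positivity, by linarith⟩
    by_cases hmem : polarCoord.symm (r, x) ∈ Prod.mk y ⁻¹' solidSlice a b c h s
    · rw [indicator_of_mem hmem, indicator_of_mem (hiff.1 hmem)]; simp
    · rw [indicator_of_notMem hmem, indicator_of_notMem (mt hiff.2 hmem)]; simp
  · rw [indicator_of_notMem (show y ∉ {y : ℝ | 0 ≤ s * y} from hy)]
    rw [setLIntegral_congr_fun (g := fun _ => 0) measurableSet_Ioi, lintegral_zero]
    intro r _
    have : polarCoord.symm (r, x) ∉ Prod.mk y ⁻¹' solidSlice a b c h s := fun hmem => hy hmem.2.1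
    simp only [indicator_of_notMem this, smul_zero]

/-- With the order of integration exchanged, the integral over y at fixed longitude is `height`/3.
-/
theorem volume_solidSlice (ha : a < h) (hb : b < h) (hc : h < c) (hs : s = 1 ∨ s = -1) :
    volume (solidSlice a b c h s) = ENNReal.ofReal (orbitArea a b c h / 3) := by
  have hmeas : Measurable (Function.uncurry fun y x : ℝ => {y : ℝ | 0 ≤ s * y}.indicator
      (fun y => ENNReal.ofReal ((1 - y ^ 2 / height a b c h x ^ 2) / 2)) y) := by
    have hh := (continuous_height ha hb hc).measurable
    have hset : MeasurableSet {p : ℝ × ℝ | 0 ≤ s * p.1} :=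
      measurableSet_le (by fun_prop) (by fun_prop)
    have : Measurable fun p : ℝ × ℝ =>
        ENNReal.ofReal ((1 - p.1 ^ 2 / height a b c h p.2 ^ 2) / 2) := by fun_prop
    exact this.indicator hset
  rw [Measure.volume_eq_prod, Measure.prod_apply (measurableSet_solidSlice a b c h s)]
  simp_rw [volume_solidSlice_section ha hb hc]
  rw [lintegral_lintegral_swap hmeas.aemeasurable]
  simp_rw [fun x => lintegral_parabola_sign (height_pos ha hb hc x) hs]
  rw [← ofReal_integral_eq_lintegral_ofReal, ← integral_Ioc_eq_integral_Ioo,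
    ← intervalIntegral.integral_of_le (by linarith [pi_pos]), intervalIntegral.integral_div,
    orbitArea]
  · refine IntegrableOn.mono_set ?_ Ioo_subset_Ioc_self
    exact (((continuous_height ha hb hc).div_const 3).intervalIntegrable (-π) π).1
  · exact Eventually.of_forall fun x => (div_pos (height_pos ha hb hc x) three_pos).le

end

/-! ### The slice in principal coordinates -/

/-- The cone over the part of the sphere on the side `s` of the equator, with energy at most
`h / 2`. -/
def sliceCone (a b c h s : ℝ) : Set (Fin 3 → ℝ) :=
  {v | (c - h) * v 2 ^ 2 ≤ (h - a) * v 0 ^ 2 + (h - b) * v 1 ^ 2 ∧ 0 ≤ s * v 2}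

theorem smul_mem_sliceCone_iff {a b c h s r : ℝ} (hr : 0 < r) (v : Fin 3 → ℝ) :
    r • v ∈ sliceCone a b c h s ↔ v ∈ sliceCone a b c h s := by
  have hr2 : 0 < r ^ 2 := pow_pos hr 2
  simp only [sliceCone, mem_ofPred_eq, Pi.smul_apply, smul_eq_mul, mul_pow]
  refine and_congr ?_ ?_
  · rw [← mul_le_mul_iff_right₀ hr2 (b := (c - h) * v 2 ^ 2)]
    ring_nf
  · rw [mul_left_comm, mul_nonneg_iff_of_pos_left hr]

theorem mem_equatorSlice_rotation_iff {R : Matrix (Fin 3) (Fin 3) ℝ}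
    (hR : R ∈ Matrix.specialOrthogonalGroup (Fin 3) ℝ) (u : Fin 3 → ℝ) (l : ℝ)
    (N : ℝ → Fin 3 → ℝ) (x : Fin 3 → ℝ) :
    x ∈ equatorSlice (R *ᵥ u) l (range fun t => R *ᵥ N t) ↔
      Rᵀ *ᵥ x ∈ equatorSlice u l (range N) := by
  obtain ⟨v, rfl⟩ : ∃ v, x = R *ᵥ v :=
    ⟨Rᵀ *ᵥ x, by rw [Matrix.mulVec_mulVec, mul_transpose_self_of_rotation hR, Matrix.one_mulVec]⟩
  have hinj : Function.Injective (R *ᵥ ·) := fun v w hvw => by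
    have := congrArg (Rᵀ *ᵥ ·) hvw
    simpa [Matrix.mulVec_mulVec, transpose_mul_self_of_rotation hR] using this
  rw [Matrix.mulVec_mulVec, transpose_mul_self_of_rotation hR, Matrix.one_mulVec]
  simp only [equatorSlice, mem_ofPred_eq, exists_range_iff, rotation_dotProduct hR,
    ← Matrix.mulVec_smul, ← Matrix.mulVec_sub, hinj.eq_iff]

section

variable {a b c h l s : ℝ} {N : ℝ → Fin 3 → ℝ} {u : ℝ → ℝ}

/-- The cone inequality is the homogeneous form of a x² + b y² + c z² ≤ h |v|², with equality on the
orbit. A point of the sphere is compared with the orbit point on its meridian: moving towards the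
pole increases z² and shrinks the horizontal part, which can only violate the inequality. -/
theorem mem_equatorSlice_iff
    (H : IsEulerOrbit a b c h l (fun t => N t 0) (fun t => N t 1) fun t => N t 2)
    (U : IsLongitude a b c h l (fun t => N t 0) (fun t => N t 1) (fun t => N t 2) u s)
    (hl : 0 < l) (ha : a < h) (hb : b < h) (hc : h < c) (v : Fin 3 → ℝ) :
    v ∈ equatorSlice ![0, 0, 1] l (range N) ↔
      v ⬝ᵥ v = l ^ 2 ∧ v ∈ sliceCone a b c h s := by
  have hdot : ∀ w : Fin 3 → ℝ, w ⬝ᵥ ![0, 0, 1] = w 2 := fun w => by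
    simp [dotProduct, Fin.sum_univ_three]
  have hvv : v ⬝ᵥ v = v 0 ^ 2 + v 1 ^ 2 + v 2 ^ 2 := by
    simp only [dotProduct, Fin.sum_univ_three]; ring
  have hperp : ∀ (w : Fin 3 → ℝ) (r : ℝ), v - v 2 • ![0, 0, 1] = r • (w - w 2 • ![0, 0, 1]) ↔
      v 0 = r * w 0 ∧ v 1 = r * w 1 := fun w r => by
    rw [funext_iff, Fin.forall_fin_succ, Fin.forall_fin_two]
    simp [-Matrix.cons_val_zero, -Matrix.cons_val_one, -Matrix.smul_cons]
  have hN : ∀ t, (c - h) * N t 2 ^ 2 = (h - a) * N t 0 ^ 2 + (h - b) * N t 1 ^ 2 := fun t => by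
    linear_combination H.energy t - h * H.sphere t
  have hpos : ∀ t, 0 < N t 0 ^ 2 + N t 1 ^ 2 := H.transverse_pos hl hc
  have hsz : ∀ t, 0 < s * N t 2 := fun t => by
    rw [U.z_eq, ← mul_assoc, ← mul_assoc, U.sq_sign, one_mul]
    exact mul_pos hl (height_pos ha hb hc _)
  have hsph : ∀ t, N t 0 ^ 2 + N t 1 ^ 2 + N t 2 ^ 2 = l ^ 2 := H.sphere
  have hch := sub_pos.2 hc
  have hIcc : ∀ t, v 2 ∈ uIcc 0 (N t 2) ↔ 0 ≤ s * v 2 ∧ v 2 ^ 2 ≤ N t 2 ^ 2 := fun t => by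
    have h1 := hsz t
    rw [sq_le_sq]
    rcases U.sign with rfl | rfl
    · rw [one_mul] at h1 ⊢
      rw [uIcc_of_le h1.le, mem_Icc, abs_of_pos h1]
      exact and_congr_right fun h2 => by rw [abs_of_nonneg h2]
    · have h1' : N t 2 < 0 := by linarith
      rw [uIcc_of_ge h1'.le, mem_Icc, abs_of_neg h1']
      constructor
      · rintro ⟨h2, h3⟩
        exact ⟨by linarith, by rw [abs_of_nonpos h3]; linarith⟩
      · rintro ⟨h2, h3⟩
        rw [abs_of_nonpos (by linarith)] at h3
        exact ⟨by linarith, by linarith⟩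
  simp only [equatorSlice, sliceCone, mem_ofPred_eq, exists_range_iff, hdot, hperp, hIcc, hvv]
  refine and_congr_right fun hv => ?_
  constructor
  · rintro ⟨t, ⟨r, hr, h0, h1⟩, hs0, hle⟩
    refine ⟨?_, hs0⟩
    -- On the common sphere, a smaller |z| means a larger horizontal part.
    have hr1 : 1 ≤ r ^ 2 := by
      have h2 : N t 0 ^ 2 + N t 1 ^ 2 ≤ r ^ 2 * (N t 0 ^ 2 + N t 1 ^ 2) := by
        rw [h0, h1] at hv
        linarith [hsph t]
      by_contra hcon
      nlinarith [hpos t]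
    rw [h0, h1]
    calc (c - h) * v 2 ^ 2 ≤ (c - h) * N t 2 ^ 2 := mul_le_mul_of_nonneg_left hle hch.le
      _ ≤ r ^ 2 * ((c - h) * N t 2 ^ 2) :=
          le_mul_of_one_le_left (mul_nonneg hch.le (sq_nonneg _)) hr1
      _ = _ := by rw [hN]; ring
  · rintro ⟨hle, hs0⟩
    have hvpos : 0 < v 0 ^ 2 + v 1 ^ 2 := by
      by_contra hcon
      have e0 : v 0 ^ 2 = 0 := by nlinarith [sq_nonneg (v 0), sq_nonneg (v 1)]
      have e1 : v 1 ^ 2 = 0 := by nlinarith [sq_nonneg (v 0), sq_nonneg (v 1)]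
      rw [e0, e1] at hle hv
      nlinarith [mul_pos hch (pow_pos hl 2)]
    obtain ⟨φ, p0, p1⟩ := exists_polar (v 0) (v 1)
    -- The orbit goes all the way around the axis, so it meets the meridian of v.
    obtain ⟨t, rfl⟩ := longitude_surjective U hl ha hb hc φ
    have hρ : 0 < l * √(1 - height a b c h (u t) ^ 2) := by
      refine mul_pos hl (Real.sqrt_pos.2 ?_)
      nlinarith [height_pos ha hb hc (u t), height_lt_one ha hb hc (u t)]
    have x_eq : N t 0 = _ := U.x_eq t
    have y_eq : N t 1 = _ := U.y_eq t
    set ρ := l * √(1 - height a b c h (u t) ^ 2)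
    set ρ' := √(v 0 ^ 2 + v 1 ^ 2)
    have hρ' : 0 < ρ' := Real.sqrt_pos.2 hvpos
    have h0 : v 0 = ρ' / ρ * N t 0 := by rw [p0, x_eq]; field_simp
    have h1 : v 1 = ρ' / ρ * N t 1 := by rw [p1, y_eq]; field_simp
    have hr : 0 < ρ' / ρ := div_pos hρ' hρ
    set r := ρ' / ρ
    refine ⟨t, ⟨r, hr, h0, h1⟩, hs0, ?_⟩
    by_contra hcon
    rw [not_le] at hcon
    have hr1 : r ^ 2 ≤ 1 := by
      have h2 : r ^ 2 * (N t 0 ^ 2 + N t 1 ^ 2) ≤ N t 0 ^ 2 + N t 1 ^ 2 := by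
        rw [h0, h1] at hv
        linarith [hsph t]
      by_contra hcon
      nlinarith [hpos t]
    have h3 : (c - h) * N t 2 ^ 2 < (c - h) * v 2 ^ 2 := mul_lt_mul_of_pos_left hcon hch
    have h4 : (h - a) * v 0 ^ 2 + (h - b) * v 1 ^ 2 = r ^ 2 * ((c - h) * N t 2 ^ 2) := by
      rw [hN, h0, h1]; ring
    have h5 : r ^ 2 * ((c - h) * N t 2 ^ 2) ≤ (c - h) * N t 2 ^ 2 :=
      mul_le_of_le_one_left (mul_nonneg hch.le (sq_nonneg _)) hr1
    linarith

end

/-! ### The solid angle -/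

/-- Coordinates with the third one first. -/
theorem measurePreserving_third_first :
    MeasurePreserving (fun v : Fin 3 → ℝ => (v 2, (v 0, v 1))) volume volume := by
  have h1 := volume_preserving_piFinSuccAbove (fun _ : Fin 3 => ℝ) 2
  have h2 := volume_preserving_finTwoArrow ℝ
  exact ((MeasurePreserving.id (volume : Measure ℝ)).prod h2).comp h1

theorem measurePreserving_rotation {R : Matrix (Fin 3) (Fin 3) ℝ}
    (hR : R ∈ Matrix.specialOrthogonalGroup (Fin 3) ℝ) :
    MeasurePreserving (fun v : Fin 3 → ℝ => R *ᵥ v) volume volume := by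
  have hdet := (Matrix.mem_specialOrthogonalGroup_iff.1 hR).2
  refine ⟨(Continuous.matrix_mulVec continuous_const continuous_id).measurable, ?_⟩
  have := Real.map_matrix_volume_pi_eq_smul_volume_pi (M := R) (by rw [hdet]; exact one_ne_zero)
  rw [hdet, inv_one, abs_one, ENNReal.ofReal_one, one_smul] at this
  exact this

-- `Measure.toSphere` of a set is the dimension 3 times the volume of the open cone over it. The
-- slice condition is invariant under positive scaling, so in rotated coordinates this cone is
-- `solidSlice`, and the factor 3 cancels the 1/3 of `volume_solidSlice`.
open scoped Pointwise in
theorem toSphere_sliceCone {a b c h s : ℝ} (ha : a < h) (hb : b < h) (hc : h < c)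
    (hs : s = 1 ∨ s = -1) {R : Matrix (Fin 3) (Fin 3) ℝ}
    (hR : R ∈ Matrix.specialOrthogonalGroup (Fin 3) ℝ) :
    (volume : Measure (EuclideanSpace ℝ (Fin 3))).toSphere
      {x : Metric.sphere (0 : EuclideanSpace ℝ (Fin 3)) 1 |
        R *ᵥ (x : EuclideanSpace ℝ (Fin 3)).ofLp ∈ sliceCone a b c h s} =
      ENNReal.ofReal (orbitArea a b c h) := by
  have hcont : Continuous fun x : Metric.sphere (0 : EuclideanSpace ℝ (Fin 3)) 1 =>
      R *ᵥ (x : EuclideanSpace ℝ (Fin 3)).ofLp :=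
    Continuous.matrix_mulVec continuous_const
      ((PiLp.continuous_ofLp 2 _).comp continuous_subtype_val)
  have hcone : MeasurableSet (sliceCone a b c h s) := by
    have h1 : MeasurableSet {v : Fin 3 → ℝ |
        (c - h) * v 2 ^ 2 ≤ (h - a) * v 0 ^ 2 + (h - b) * v 1 ^ 2} :=
      measurableSet_le (by fun_prop) (by fun_prop)
    have h2 : MeasurableSet {v : Fin 3 → ℝ | 0 ≤ s * v 2} :=
      measurableSet_le (by fun_prop) (by fun_prop)
    exact h1.inter h2
  have hm : MeasurableSet {x : Metric.sphere (0 : EuclideanSpace ℝ (Fin 3)) 1 |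
        R *ᵥ (x : EuclideanSpace ℝ (Fin 3)).ofLp ∈ sliceCone a b c h s} :=
    hcont.measurable hcone
  have hnorm : ∀ x : EuclideanSpace ℝ (Fin 3), ‖x‖ ^ 2 =
      (R *ᵥ x.ofLp) 0 ^ 2 + (R *ᵥ x.ofLp) 1 ^ 2 + (R *ᵥ x.ofLp) 2 ^ 2 := fun x => by
    have h1 := rotation_dotProduct hR x.ofLp x.ofLp
    rw [EuclideanSpace.norm_sq_eq]
    simp only [dotProduct, Fin.sum_univ_three, Real.norm_eq_abs, sq_abs] at h1 ⊢
    linarith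
  have hset : Ioo (0 : ℝ) 1 • (Subtype.val '' {x : Metric.sphere (0 : EuclideanSpace ℝ (Fin 3)) 1 |
        R *ᵥ (x : EuclideanSpace ℝ (Fin 3)).ofLp ∈ sliceCone a b c h s}) =
      (fun x : EuclideanSpace ℝ (Fin 3) => ((R *ᵥ x.ofLp) 2, ((R *ᵥ x.ofLp) 0, (R *ᵥ x.ofLp) 1)))
        ⁻¹' solidSlice a b c h s := by
    ext x
    have hmem : (x ∈ (fun x : EuclideanSpace ℝ (Fin 3) =>
        ((R *ᵥ x.ofLp) 2, ((R *ᵥ x.ofLp) 0, (R *ᵥ x.ofLp) 1))) ⁻¹' solidSlice a b c h s) ↔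
        R *ᵥ x.ofLp ∈ sliceCone a b c h s ∧ 0 < ‖x‖ ∧ ‖x‖ < 1 := by
      have hpos : 0 < ‖x‖ ↔ 0 < ‖x‖ ^ 2 :=
        ⟨fun h => pow_pos h 2, fun h => (norm_nonneg x).lt_of_ne'
          (pow_ne_zero_iff two_ne_zero |>.1 h.ne')⟩
      rw [hpos, ← sq_lt_one_iff₀ (norm_nonneg x), hnorm]
      simp only [mem_preimage, solidSlice, sliceCone, mem_ofPred_eq, and_assoc]
    rw [hmem, Set.mem_smul]
    constructor
    · rintro ⟨r, ⟨hr0, hr1⟩, -, ⟨y, hy, rfl⟩, rfl⟩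
      have hy1 : ‖(y : EuclideanSpace ℝ (Fin 3))‖ = 1 := by simp
      rw [norm_smul, hy1, mul_one, Real.norm_eq_abs, abs_of_pos hr0, WithLp.ofLp_smul,
        Matrix.mulVec_smul, smul_mem_sliceCone_iff hr0]
      exact ⟨hy, hr0, hr1⟩
    · rintro ⟨hx, h0, h1⟩
      refine ⟨‖x‖, ⟨h0, h1⟩, ‖x‖⁻¹ • x, ⟨⟨‖x‖⁻¹ • x, ?_⟩, ?_, rfl⟩, ?_⟩
      · rw [mem_sphere_zero_iff_norm, norm_smul, norm_inv, norm_norm, inv_mul_cancel₀ h0.ne']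
      · simp only [mem_ofPred_eq]
        rwa [WithLp.ofLp_smul, Matrix.mulVec_smul, smul_mem_sliceCone_iff (inv_pos.2 h0)]
      · simp only [smul_smul]
        rw [mul_inv_cancel₀ h0.ne', one_smul]
  have hmp : MeasurePreserving (fun x : EuclideanSpace ℝ (Fin 3) =>
      ((R *ᵥ x.ofLp) 2, ((R *ᵥ x.ofLp) 0, (R *ᵥ x.ofLp) 1))) volume volume :=
    (measurePreserving_third_first.comp (measurePreserving_rotation hR)).comp
      (PiLp.volume_preserving_ofLp (Fin 3))
  rw [Measure.toSphere_apply' _ hm, hset,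
    hmp.measure_preimage (measurableSet_solidSlice a b c h s).nullMeasurableSet,
    volume_solidSlice ha hb hc hs, finrank_euclideanSpace_fin, ← ENNReal.ofReal_natCast,
    ← ENNReal.ofReal_mul (by positivity)]
  congr 1
  push_cast
  ring

theorem orbitArea_nonneg (a b c h : ℝ) : 0 ≤ orbitArea a b c h :=
  intervalIntegral.integral_nonneg (by linarith [pi_pos]) fun _ _ => Real.sqrt_nonneg _

/-- The solid angle between the equator and the orbit. -/
theorem sphereSolidAngle_equatorSlice {a b c h l s : ℝ} {N : ℝ → Fin 3 → ℝ} {u : ℝ → ℝ}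
    (H : IsEulerOrbit a b c h l (fun t => N t 0) (fun t => N t 1) fun t => N t 2)
    (U : IsLongitude a b c h l (fun t => N t 0) (fun t => N t 1) (fun t => N t 2) u s)
    (hl : 0 < l) (ha : a < h) (hb : b < h) (hc : h < c) {R : Matrix (Fin 3) (Fin 3) ℝ}
    (hR : R ∈ Matrix.specialOrthogonalGroup (Fin 3) ℝ) :
    sphereSolidAngle l (equatorSlice (R *ᵥ ![0, 0, 1]) l (range fun t => R *ᵥ N t)) =
      orbitArea a b c h := by
  rw [sphereSolidAngle, ← ENNReal.toReal_ofReal (orbitArea_nonneg a b c h),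
    ← toSphere_sliceCone ha hb hc U.sign (transpose_mem_rotation hR)]
  congr 2
  ext x
  have hx : (x : EuclideanSpace ℝ (Fin 3)).ofLp ⬝ᵥ (x : EuclideanSpace ℝ (Fin 3)).ofLp = 1 := by
    have h1 : ‖(x : EuclideanSpace ℝ (Fin 3))‖ = 1 := by simp
    have h2 := EuclideanSpace.norm_sq_eq (x : EuclideanSpace ℝ (Fin 3))
    rw [h1] at h2
    simp only [dotProduct, Fin.sum_univ_three, Real.norm_eq_abs, sq_abs] at h2 ⊢
    linarith
  have hsmul : (fun i => l * (x : EuclideanSpace ℝ (Fin 3)) i) =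
      l • (x : EuclideanSpace ℝ (Fin 3)).ofLp := rfl
  simp only [mem_ofPred_eq]
  rw [hsmul, mem_equatorSlice_rotation_iff hR, mem_equatorSlice_iff H U hl ha hb hc,
    rotation_dotProduct (transpose_mem_rotation hR), smul_dotProduct, dotProduct_smul, hx,
    Matrix.mulVec_smul, smul_mem_sliceCone_iff hl]
  simp [sq]

/-! ### Dives -/

namespace KickDive

variable {J : Fin 3 → ℝ} (d : KickDive J)

theorem ell_dotProduct : d.ell ⬝ᵥ d.ell = d.l ^ 2 := by
  rw [← d.stage1.dotProduct_momentum 0, d.stage1_equilibrium]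
  simp [dotProduct, Fin.sum_univ_three, sq]

/-- The angular momentum is still (0, l, 0) at the end of the steady stage 1, and the kick turns it.
Thus `Et` is the energy of the actual stage 3 motion at its start. -/
theorem momentum_zero : d.momentum 0 = Rx (-d.chi) *ᵥ ![0, d.l, 0] := by
  rw [momentum, d.stage2, Matrix.transpose_mul, ← Matrix.mulVec_mulVec,
    d.stage1.steady d.Is_pos d.stage1_equilibrium, Rx_neg]

/-- The angular momentum in the principal axes of the twisting stage. -/
def principalMomentum (t : ℝ) : Fin 3 → ℝ := (d.R3 t * Rx d.P)ᵀ *ᵥ d.ell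

theorem momentum_eq (t : ℝ) : d.momentum t = Rx d.P *ᵥ d.principalMomentum t := by
  rw [principalMomentum, Matrix.transpose_mul, Matrix.mulVec_mulVec, ← Matrix.mul_assoc,
    mul_transpose_self_of_rotation (Rx_mem_rotation _), Matrix.one_mul, momentum]

theorem Et_eq (hJ : ∀ i, 0 < J i) :
    2 * d.Et = (J 0)⁻¹ * d.principalMomentum 0 0 ^ 2 + (J 1)⁻¹ * d.principalMomentum 0 1 ^ 2 +
      (J 2)⁻¹ * d.principalMomentum 0 2 ^ 2 := by
  rw [Et, ← momentum_zero, rigidEnergy, inv_twistInertia hJ, momentum_eq, Matrix.mulVec_mulVec,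
    Matrix.mul_assoc, transpose_mul_self_of_rotation (Rx_mem_rotation _), Matrix.mul_one,
    ← Matrix.mulVec_mulVec, rotation_dotProduct (Rx_mem_rotation _), inv_diagonal hJ]
  simp only [dotProduct, Fin.sum_univ_three, Matrix.mulVec_diagonal]
  ring

theorem isEulerOrbit (hJ : ∀ i, 0 < J i) :
    IsEulerOrbit (J 0)⁻¹ (J 1)⁻¹ (J 2)⁻¹ (2 * (d.Et / d.l ^ 2)) d.l
      (fun t => d.principalMomentum t 0) (fun t => d.principalMomentum t 1)
      fun t => d.principalMomentum t 2 := by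
  have F := d.stage3.principal hJ
  have E := F.euler hJ (L := d.principalMomentum) fun _ => rfl
  refine ⟨fun t => (E t).1, fun t => (E t).2.1, fun t => (E t).2.2, fun t => ?_, fun t => ?_⟩
  · have h := (F.dotProduct_momentum t).trans d.ell_dotProduct
    change d.principalMomentum t ⬝ᵥ d.principalMomentum t = _ at h
    simp only [dotProduct, Fin.sum_univ_three] at h
    linarith
  · have hd : ∀ t, HasDerivAt (fun t => (J 0)⁻¹ * d.principalMomentum t 0 ^ 2 +
        (J 1)⁻¹ * d.principalMomentum t 1 ^ 2 + (J 2)⁻¹ * d.principalMomentum t 2 ^ 2) 0 t :=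
      fun t => by
        obtain ⟨e0, e1, e2⟩ := E t
        refine ((((e0.pow 2).const_mul _).add ((e1.pow 2).const_mul _)).add
          ((e2.pow 2).const_mul _)).congr_deriv ?_
        ring
    have h := is_const_of_deriv_eq_zero (fun t => (hd t).differentiableAt)
      (fun t => (hd t).deriv) t 0
    rw [h, ← d.Et_eq hJ]
    have := d.l_pos.ne'
    field_simp

end KickDive

end TwistingSomersault

end

/-! ### The corollary -/

open TwistingSomersault in
theorem mainTheorem4 (J : Fin 3 → ℝ) (hJ : ∀ i, 0 < J i) :
    ∃ sigma theta : ℝ → ℝ, ∀ d : TwistingSomersault.KickDive J, d.IsTwisting →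
      IsLeast d.periods d.Tt ∧
      d.S = sigma (d.Et / d.l ^ 2) ∧
      d.l * d.Tt = theta (d.Et / d.l ^ 2) ∧
      (d.IsPure → ∀ (m : ℝ) (n : ℕ), d.HasTwists n →
        (d.HasSomersaults m ↔
          2 * Real.pi * m = (2 * (d.l * d.Tt) * (d.Et / d.l ^ 2) - d.S) * n) ∧
        (d.HasSomersaults m → 0 < n → d.IsRotationNumber (m / n))) := by
  -- Both witnesses live on the unit sphere, where the orbit depends only on the inverse moments and
  -- h = 2e. The scale l enters time alone, as the factor in l T_t.
  refine ⟨fun e => orbitArea (J 0)⁻¹ (J 1)⁻¹ (J 2)⁻¹ (2 * e),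
    fun e => orbitPeriod (J 0)⁻¹ (J 1)⁻¹ (J 2)⁻¹ (2 * e), fun d hd => ?_⟩
  have hl := d.l_pos
  have hl2 : 0 < d.l ^ 2 := pow_pos hl 2
  have H := d.isEulerOrbit hJ
  set h := 2 * (d.Et / d.l ^ 2) with hh
  set a := (J 0)⁻¹ with haJ
  set b := (J 1)⁻¹ with hbJ
  set c := (J 2)⁻¹ with hcJ
  have hquot : ∀ j : ℝ, 0 < j → d.l ^ 2 / (2 * j) = j⁻¹ * (d.l ^ 2 / 2) := fun j hj => by
    field_simp
  have hEt : d.Et = h * (d.l ^ 2 / 2) := by rw [hh]; field_simp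
  obtain ⟨ha, hb, hc⟩ : a < h ∧ b < h ∧ h < c := by
    obtain ⟨h0, h1, h2⟩ := hd
    rw [hquot _ (hJ _), hEt] at h0 h1 h2
    exact ⟨lt_of_mul_lt_mul_right h0 (by positivity), lt_of_mul_lt_mul_right h1 (by positivity),
      lt_of_mul_lt_mul_right h2 (by positivity)⟩
  obtain ⟨u, s, U⟩ := H.exists_isLongitude hl ha hb hc
  have hinj : Function.Injective (Rx d.P *ᵥ ·) := fun v w hvw => by
    have := congrArg ((Rx d.P)ᵀ *ᵥ ·) hvw
    simpa [Matrix.mulVec_mulVec, transpose_mul_self_of_rotation (Rx_mem_rotation _)] using this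
  -- The momentum in body and in principal axes differs by a fixed rotation, so the periods agree.
  have hper : d.periods = {T | 0 < T ∧ ∀ t,
      d.principalMomentum (t + T) 0 = d.principalMomentum t 0 ∧
      d.principalMomentum (t + T) 1 = d.principalMomentum t 1 ∧
      d.principalMomentum (t + T) 2 = d.principalMomentum t 2} := by
    ext T
    simp only [KickDive.periods, d.momentum_eq, Set.mem_ofPred_eq, hinj.eq_iff, funext_iff,
      Fin.forall_fin_succ]
    simp
  have hleast := isLeast_periods U hl ha hb hc
  rw [← hper] at hleast
  have hT : d.Tt = orbitPeriod a b c h / d.l := hleast.csInf_eq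
  have hS : d.S = orbitArea a b c h := by
    rw [KickDive.S, KickDive.twistAxis, show d.momentum = fun t => _ from funext d.momentum_eq]
    exact sphereSolidAngle_equatorSlice H U hl ha hb hc (Rx_mem_rotation d.P)
  have hlT : d.l * d.Tt = orbitPeriod a b c h := by rw [hT]; field_simp
  refine ⟨hT ▸ hleast, hS, hlT, fun hpure m n hn => ?_⟩
  have hucont : Continuous u := continuous_iff_continuousAt.2 fun t => (U.deriv t).continuousAt
  obtain ⟨⟨φ, hφ⟩, hderiv⟩ := (d.stage3.principal hJ).axis_angle hJ hl d.ell_dotProduct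
    (L := d.principalMomentum) (fun _ => rfl)
    (k := fun t => d.l * transverse a b (u t))
    (continuous_const.mul (continuous_transverse.comp hucont)) (H.transverse_pos hl hc)
    (fun t => by
      have e := Real.cos_sq_add_sin_sq (u t)
      rw [U.x_eq, U.y_eq, transverse]
      linear_combination (-(d.l * (a * Real.cos (u t) ^ 2 + b * Real.sin (u t) ^ 2) *
        (d.l * √(1 - height a b c h (u t) ^ 2)) ^ 2)) * e)
  have haxis : (fun t => (d.R3 t * Rx d.P) *ᵥ ![0, 0, 1]) = fun t => d.R3 t *ᵥ d.twistAxis := by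
    ext1 t
    rw [KickDive.twistAxis, Matrix.mulVec_mulVec]
  rw [haxis] at hφ hderiv
  have hrot : ∀ φ, IsAngleAbout d.ell (fun t => d.R3 t *ᵥ d.twistAxis) φ →
      φ (d.tau 2) - φ 0 = (h * orbitPeriod a b c h - orbitArea a b c h) * n := fun φ hφ => by
    have := rotation_add_periods U hl ha hb hc (hderiv φ hφ) n 0
    rw [zero_add, ← hT, ← hn] at this
    linarith
  have hval : (2 * (d.l * d.Tt) * (d.Et / d.l ^ 2) - d.S) * n =
      (h * orbitPeriod a b c h - orbitArea a b c h) * n := by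
    rw [hlT, hS, hh]; ring
  obtain ⟨h0, -, -, h4⟩ := hpure
  have hiff : d.HasSomersaults m ↔
      2 * Real.pi * m = (2 * (d.l * d.Tt) * (d.Et / d.l ^ 2) - d.S) * n := by
    rw [hval]
    constructor
    · rintro ⟨φ1, φ3, φ5, -, hφ3, -, e⟩
      rw [h0, h4, hrot φ3 hφ3] at e
      linarith
    · intro e
      -- Stages 1 and 5 have no duration and contribute nothing, but the total rotation still asks
      -- for continuous angles in them.
      obtain ⟨φ1, hφ1⟩ :=
        d.stage1.exists_steady_angle d.Is_pos hl d.ell_dotProduct d.stage1_equilibrium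
      obtain ⟨φ5, hφ5⟩ :=
        d.stage5.exists_steady_angle d.Is_pos hl d.ell_dotProduct d.stage5_equilibrium
      refine ⟨φ1, φ, φ5, hφ1, hφ, hφ5, ?_⟩
      rw [h0, h4, hrot φ hφ]
      linarith
  refine ⟨hiff, fun hm hn0 => ⟨φ, hφ, ?_⟩⟩
  have hn' : (0 : ℝ) < n := by exact_mod_cast hn0
  have hmn : m / n = (h * orbitPeriod a b c h - orbitArea a b c h) / (2 * Real.pi) := by
    have := hiff.1 hm
    rw [hval] at this
    have := Real.pi_pos
    field_simp
    linarith
  rw [hmn]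
  refine tendsto_mean_of_add_period hφ.1 (hT ▸ hleast.1.1) fun t => ?_
  have := rotation_add_periods U hl ha hb hc (hderiv φ hφ) 1 t
  rw [Nat.cast_one, one_mul, one_mul, ← hT] at this
  exact this
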